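/- Let $k\ge 1$ be an integer, put $\kappa=2^{k-1}$, and let $\varepsilon>0$. There is a constant $C=C(k,\varepsilon)>0$, depending only on $k$ and $\varepsilon$, with the following property. Let $K\subset\mathbb C$ be any imaginary quadratic number field with ring of integers $\mathcal O_K$, norm $\mathcal N$ and discriminant $D_K<0$, and for $z\in\mathbb C$ put $$\widetilde e_K(z)=\exp\left(2\pi i\left(\frac{z}{\sqrt{D_K}}-\frac{\overline z}{\sqrt{D_K}}\right)\right),\qquad \sqrt{D_K}=i\sqrt{|D_K|}.$$ Then for all real $Q,N\ge 1$ and every family $(a_n)_{n\in\mathcal O_K}$ of complex numbers, $$\sum_{\substack{q\in\mathcal O_K\setminus\{0\}\\ \mathcal N(q)\le Q}}\ \sum_{\substack{r \bmod q^k\\ (r,q)=1}}\left|\sum_{\substack{n\in\mathcal O_K\\ \mathcal N(n)\le N}}a_n\,\widetilde e_K\left(\frac{nr}{q^k}\right)\right|^2\le C\,(QN)^{\varepsilon}\left(Q^{k+1}+NQ^{1-1/\kappa}+N^{1-1/\kappa}Q^{1+k/\kappa}\right)\sum_{\substack{n\in\mathcal O_K\\ \mathcal N(n)\le N}}|a_n|^2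 .$$ -/

import Mathlib

open NumberField

/-- The additive character `exp(2πi (z/√D - z̄/√D))` of `z ∈ ℂ`, where `D < 0` is the discriminant
of the field and `√D = i√|D|`. -/
noncomputable def eTilde (D : ℤ) (z : ℂ) : ℂ :=
  Complex.exp (2 * Real.pi * Complex.I *
    (z / (Complex.I * Real.sqrt (-(D : ℝ))) -
      starRingEnd ℂ z / (Complex.I * Real.sqrt (-(D : ℝ)))))

/-- In an imaginary quadratic field the norm of `n` is `|φ n|²`, for any complex embedding `φ`. -/
theorem norm_eq_sq_norm (K : Type*) [Field K] [NumberField K]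
    [Algebra.IsQuadraticExtension ℚ K] [IsTotallyComplex K] (φ : K →+* ℂ) (n : 𝓞 K) :
    ((Algebra.norm ℤ n : ℤ) : ℝ) = ‖φ n‖ ^ 2 := by
  classical
  have hne : φ ≠ ComplexEmbedding.conjugate φ := fun h =>
    (InfinitePlace.isComplex_mk_iff.mp (IsTotallyComplex.isComplex (InfinitePlace.mk φ))) h.symm
  have huniv : (Finset.univ : Finset (K →ₐ[ℚ] ℂ)) =
      {φ.toRatAlgHom, (ComplexEmbedding.conjugate φ).toRatAlgHom} := by
    symm
    apply Finset.eq_univ_of_card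
    rw [AlgHom.card, Algebra.IsQuadraticExtension.finrank_eq_two ℚ K, Finset.card_pair]
    intro h
    exact hne (RingHom.ext fun x => by simpa using DFunLike.congr_fun h x)
  have h1 := Algebra.norm_eq_prod_embeddings ℚ ℂ (n : K)
  rw [huniv, Finset.prod_pair (by
    intro h
    exact hne (RingHom.ext fun x => by simpa using DFunLike.congr_fun h x))] at h1
  rw [← Algebra.coe_norm_int] at h1
  simp only [RingHom.toRatAlgHom_apply, ComplexEmbedding.conjugate_coe_eq, Complex.mul_conj,
    Complex.normSq_eq_norm_sq] at h1
  have h2 : ((Algebra.norm ℤ n : ℤ) : ℂ) = ((‖φ n‖ ^ 2 : ℝ) : ℂ) := by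
    rw [← h1]; simp
  exact_mod_cast h2

/-- An imaginary quadratic field has only finitely many integers of bounded norm. -/
theorem finite_norm_le (K : Type*) [Field K] [NumberField K]
    [Algebra.IsQuadraticExtension ℚ K] [IsTotallyComplex K] (X : ℝ) :
    {n : 𝓞 K | ((Algebra.norm ℤ n : ℤ) : ℝ) ≤ X}.Finite := by
  refine ((Embeddings.finite_of_norm_le K ℂ (Real.sqrt X)).preimage
    (f := fun n : 𝓞 K => (n : K)) RingOfIntegers.coe_injective.injOn).subset ?_
  intro n hn
  refine ⟨n.isIntegral_coe, fun φ => ?_⟩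
  apply Real.le_sqrt_of_sq_le
  rw [← norm_eq_sq_norm]
  exact hn

/-- The finite set of all `n ∈ 𝓞 K` of norm at most `X`. -/
noncomputable def normBall (K : Type*) [Field K] [NumberField K]
    [Algebra.IsQuadraticExtension ℚ K] [IsTotallyComplex K] (X : ℝ) : Finset (𝓞 K) :=
  (finite_norm_le K X).toFinset

/-- The finite set of all nonzero `q ∈ 𝓞 K` of norm at most `X`. -/
noncomputable def nonzeroNormBall (K : Type*) [Field K] [NumberField K]
    [Algebra.IsQuadraticExtension ℚ K] [IsTotallyComplex K] (X : ℝ) : Finset (𝓞 K) :=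
  ((finite_norm_le K X).sdiff (t := {0})).toFinset

/-- The set of residue classes `r` modulo `q ^ k` with `r` coprime to `q`. -/
def reducedResidues {K : Type*} [Field K] (q : 𝓞 K) (k : ℕ) :
    Set (𝓞 K ⧸ Ideal.span {q ^ k}) :=
  {r | IsCoprime (Quotient.out r) q}

/-- For `q ≠ 0` there are finitely many residue classes modulo `q ^ k`. -/
theorem reducedResidues_finite {K : Type*} [Field K] [NumberField K] {q : 𝓞 K} (hq : q ≠ 0)
    (k : ℕ) : (reducedResidues q k).Finite := by
  have := Ideal.finiteQuotientOfFreeOfNeBot (Ideal.span {q ^ k})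
    (by rw [Ne, Ideal.span_singleton_eq_bot]; exact pow_ne_zero k hq)
  exact Set.toFinite _

/-- The exponential sum over `n ∈ 𝓞 K` of norm at most `N` of `a n` times the character at `n * z`,
where `z ∈ K` and `K` is regarded as a subfield of `ℂ` through `φ`. -/
noncomputable def expSum {K : Type*} [Field K] [NumberField K]
    [Algebra.IsQuadraticExtension ℚ K] [IsTotallyComplex K] (φ : K →+* ℂ) (a : 𝓞 K → ℂ)
    (N : ℝ) (z : K) : ℂ :=
  ∑ n ∈ normBall K N, a n * eTilde (discr K) (φ (n * z))

/-! Write d for `sqrtDisc K` and j = k - 1, so that κ = 2 ^ j. The proof combines a large sieve with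
a count of the fractions r / q ^ k in a small disc, and both must be uniform in the field.

The large sieve (`large_sieve`) avoids duality. All the fractions lie in P⁻¹ 𝓞 K for a suitable
integer P. The sum at a fraction is an average of a reweighted sum over nearby points of P⁻¹ 𝓞 K,
and Parseval on 𝓞 K / P applies to the latter. This costs a factor N / d times the largest number of
fractions in a disc of radius d / (12 √N).

For k = 1 these fractions are counted by determinants (`card_le_of_det`). For k ≥ 2 the count uses
Weyl differencing. If A is the set of denominators q, then by Hölder A contains about |A| ^ κ / |H|
^ (κ - j - 1) cubes of dimension j, where H contains all differences of A. Differencing q ^ (j + 1)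
along a cube gives x = h₁ ⋯ hⱼ ((j + 1)! q + c), and x g is still close to the lattice. By the
divisor bound few cubes share a nonzero x, so it remains to count lattice pairs (x, y) with x g - y
small (`card_pow_le_of_pow_mul_near`). Either their number is O((1 + ρP) ^ 2), or g is exceptionally
close to a fraction of small denominator (`exists_approx_or_card_le`); in the latter case only
boundedly many reduced fractions are near g at all (`card_le_of_approx`).

Uniformity comes from three sources: a disc of radius r contains O(1 + r + r ^ 2 / d) integers, the
divisor bound has a constant independent of the field, and the count of fractions may lose a factor
d because the sieve gains 1 / d. When d is too large for differencing to help, the trivial count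
suffices. The range N < Q ^ k is reduced to N = Q ^ k by extending the coefficients by zero. -/

/-! ### Packing bounds in the plane -/

/-- The index of the square of side `s / 2` containing `z`. -/
noncomputable def squareCell (s : ℝ) (z : ℂ) : ℤ × ℤ := (⌊z.re / (s / 2)⌋, ⌊z.im / (s / 2)⌋)

theorem abs_sub_lt_of_floor_div_eq {t x y : ℝ} (ht : 0 < t) (h : ⌊x / t⌋ = ⌊y / t⌋) :
    |x - y| < t := by
  have := Int.abs_sub_lt_one_of_floor_eq_floor h
  rw [← sub_div, abs_div, abs_of_pos ht, div_lt_one ht] at this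
  exact this

theorem norm_sub_lt_of_squareCell_eq {s : ℝ} (hs : 0 < s) {z w : ℂ}
    (h : squareCell s z = squareCell s w) : ‖z - w‖ < s := by
  have h2 : 0 < s / 2 := by positivity
  have hre := abs_sub_lt_of_floor_div_eq h2 (congrArg Prod.fst h)
  have him := abs_sub_lt_of_floor_div_eq h2 (congrArg Prod.snd h)
  have := Complex.norm_le_abs_re_add_abs_im (z - w)
  rw [Complex.sub_re, Complex.sub_im] at this
  linarith

theorem floor_div_mem_Icc {s R x : ℝ} (hs : 0 < s) (hx : |x| ≤ R) :
    ⌊x / (s / 2)⌋ ∈ Finset.Icc ⌊-(2 * R / s)⌋ ⌊2 * R / s⌋ := by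
  have e : x / (s / 2) = 2 * x / s := by field_simp
  rw [Finset.mem_Icc, e]
  constructor
  · apply Int.floor_le_floor
    rw [← neg_div]
    gcongr
    linarith [neg_abs_le x]
  · apply Int.floor_le_floor
    gcongr
    exact (le_abs_self x).trans hx

theorem squareCell_mem {s R : ℝ} (hs : 0 < s) {z : ℂ} (hz : ‖z‖ ≤ R) :
    squareCell s z ∈ Finset.Icc ⌊-(2 * R / s)⌋ ⌊2 * R / s⌋ ×ˢ
      Finset.Icc ⌊-(2 * R / s)⌋ ⌊2 * R / s⌋ :=
  Finset.mem_product.2 ⟨floor_div_mem_Icc hs ((Complex.abs_re_le_norm z).trans hz),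
    floor_div_mem_Icc hs ((Complex.abs_im_le_norm z).trans hz)⟩

theorem card_Icc_floor_le {a : ℝ} (ha : 0 ≤ a) :
    ((Finset.Icc ⌊-a⌋ ⌊a⌋).card : ℝ) ≤ 2 * a + 2 := by
  rw [Int.card_Icc]
  have h1 : ⌊-a⌋ ≤ ⌊a⌋ := Int.floor_le_floor (by linarith)
  have h2 : (((⌊a⌋ + 1 - ⌊-a⌋).toNat : ℤ) : ℝ) = ⌊a⌋ + 1 - ⌊-a⌋ := by
    rw [Int.toNat_of_nonneg (by omega)]; push_cast; ring
  rw [Int.cast_natCast] at h2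
  rw [h2]
  linarith [Int.floor_le a, Int.lt_floor_add_one (-a)]

/-- A packing bound in `ℂ × ℂ`. -/
theorem card_le_of_separated {ι : Type*} (S : Finset ι) (f g : ι → ℂ) {R₁ R₂ s₁ s₂ : ℝ}
    (hs₁ : 0 < s₁) (hs₂ : 0 < s₂) (hR₁ : 0 ≤ R₁) (hR₂ : 0 ≤ R₂)
    (hf : ∀ i ∈ S, ‖f i‖ ≤ R₁) (hg : ∀ i ∈ S, ‖g i‖ ≤ R₂)
    (hsep : ∀ i ∈ S, ∀ j ∈ S, ‖f i - f j‖ < s₁ → ‖g i - g j‖ < s₂ → i = j) :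
    (S.card : ℝ) ≤ (4 * R₁ / s₁ + 2) ^ 2 * (4 * R₂ / s₂ + 2) ^ 2 := by
  have hcard : S.card ≤ _ := Finset.card_le_card_of_injOn
    (fun i => (squareCell s₁ (f i), squareCell s₂ (g i)))
    (t := (Finset.Icc ⌊-(2 * R₁ / s₁)⌋ ⌊2 * R₁ / s₁⌋ ×ˢ Finset.Icc ⌊-(2 * R₁ / s₁)⌋ ⌊2 * R₁ / s₁⌋) ×ˢ
      (Finset.Icc ⌊-(2 * R₂ / s₂)⌋ ⌊2 * R₂ / s₂⌋ ×ˢ Finset.Icc ⌊-(2 * R₂ / s₂)⌋ ⌊2 * R₂ / s₂⌋))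
    (fun i hi => Finset.mem_product.2
      ⟨squareCell_mem hs₁ (hf i hi), squareCell_mem hs₂ (hg i hi)⟩)
    (fun i hi j hj hij => hsep i hi j hj
      (norm_sub_lt_of_squareCell_eq hs₁ (congrArg Prod.fst hij))
      (norm_sub_lt_of_squareCell_eq hs₂ (congrArg Prod.snd hij)))
  rw [Finset.card_product, Finset.card_product, Finset.card_product, ← pow_two, ← pow_two] at hcard
  have h1 := card_Icc_floor_le (a := 2 * R₁ / s₁) (by positivity)
  have h2 := card_Icc_floor_le (a := 2 * R₂ / s₂) (by positivity)
  have e1 : 4 * R₁ / s₁ = 2 * (2 * R₁ / s₁) := by ring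
  have e2 : 4 * R₂ / s₂ = 2 * (2 * R₂ / s₂) := by ring
  rw [e1, e2]
  calc (S.card : ℝ) ≤ _ := Nat.cast_le.2 hcard
    _ ≤ _ := by push_cast; gcongr

/-- A packing bound in `ℂ`. -/
theorem card_le_of_separated_one {ι : Type*} (S : Finset ι) (f : ι → ℂ) {R s : ℝ}
    (hs : 0 < s) (hR : 0 ≤ R) (hf : ∀ i ∈ S, ‖f i‖ ≤ R)
    (hsep : ∀ i ∈ S, ∀ j ∈ S, ‖f i - f j‖ < s → i = j) :
    (S.card : ℝ) ≤ 4 * (4 * R / s + 2) ^ 2 := by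
  have := card_le_of_separated S f (fun _ => 0) hs one_pos hR le_rfl hf (by simp)
    (fun i hi j hj h _ => hsep i hi j hj h)
  norm_num at this
  linarith

/-! ### Diophantine approximation by a ring whose nonzero elements have absolute value at least 1 -/

section DiscreteSubring

variable {R : Type*} [CommRing R] (ψ : R →+* ℂ)

theorem eq_of_norm_map_sub_lt_one (hψ : ∀ x : R, x ≠ 0 → 1 ≤ ‖ψ x‖) {x y : R}
    (h : ‖ψ x - ψ y‖ < 1) : x = y := by
  by_contra hne
  have := hψ (x - y) (sub_ne_zero.2 hne)
  rw [map_sub] at this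
  linarith

/-- The solutions of `‖x g - y‖ ≤ ρ` with `‖x‖ ≤ P` number `O((1 + ρ P) ^ 2)`, unless
`g` is exceptionally close to a fraction with small denominator. -/
theorem exists_approx_or_card_le (hψ : ∀ x : R, x ≠ 0 → 1 ≤ ‖ψ x‖) (g : ℂ) {P ρ : ℝ}
    (hP : 1 ≤ P) (hρ : 0 < ρ) :
    (∃ x₀ y₀ : R, x₀ ≠ 0 ∧ ‖ψ x₀‖ * ρ < 1 / 4 ∧ ‖ψ x₀ * g - ψ y₀‖ ≤ 1 / (8 * P)) ∨
    ∀ S : Finset (R × R), (∀ v ∈ S, ‖ψ v.1‖ ≤ P ∧ ‖ψ v.1 * g - ψ v.2‖ ≤ ρ) →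
      (S.card : ℝ) ≤ 10 ^ 6 * (1 + ρ * P) ^ 2 := by
  by_cases hex : ∃ x₀ y₀ : R, x₀ ≠ 0 ∧ ‖ψ x₀‖ * ρ < 1 / 4 ∧ ‖ψ x₀ * g - ψ y₀‖ ≤ 1 / (8 * P)
  · exact Or.inl hex
  refine Or.inr fun S hS => ?_
  push Not at hex
  set B : Set ℝ := {m | ∃ x y : R, x ≠ 0 ∧ ‖ψ x‖ = m ∧ ‖ψ x * g - ψ y‖ ≤ 1 / (8 * P)} with hB
  -- A scale `m` at which the points are separated.
  obtain ⟨m, hm1, hmP, hmρ, hsep⟩ : ∃ m : ℝ, 1 ≤ m ∧ m ≤ P ∧ (m = P ∨ 1 / 4 ≤ m * ρ) ∧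
      ∀ x y : R, ‖ψ x‖ < m / 2 → ‖ψ x * g - ψ y‖ < 1 / (8 * m) → x = 0 := by
    by_cases hsmall : ∃ x y : R, x ≠ 0 ∧ ‖ψ x‖ ≤ P ∧ ‖ψ x * g - ψ y‖ ≤ 1 / (8 * P)
    · obtain ⟨x1, y1, hx1, hx1P, hxy1⟩ := hsmall
      have hbdd : BddBelow B := ⟨1, by rintro _ ⟨x, y, hx, rfl, -⟩; exact hψ x hx⟩
      have hne : B.Nonempty := ⟨_, x1, y1, hx1, rfl, hxy1⟩
      have hinf1 : 1 ≤ sInf B := le_csInf hne (by rintro _ ⟨x, y, hx, rfl, -⟩; exact hψ x hx)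
      have hinfP : sInf B ≤ ‖ψ x1‖ := csInf_le hbdd ⟨x1, y1, hx1, rfl, hxy1⟩
      -- The infimum need not be attained in a general `R`, so a denominator within a factor 2 of it
      -- is used; this is why the separation below is only claimed for `‖ψ x‖ < m / 2`.
      obtain ⟨x0, y0, hx0, hx0P, hlt, hxy0⟩ : ∃ x0 y0 : R, x0 ≠ 0 ∧ ‖ψ x0‖ ≤ P ∧
          ‖ψ x0‖ < 2 * sInf B ∧ ‖ψ x0 * g - ψ y0‖ ≤ 1 / (8 * P) := by
        rcases lt_or_ge ‖ψ x1‖ (2 * sInf B) with h | h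
        · exact ⟨x1, y1, hx1, hx1P, h, hxy1⟩
        · obtain ⟨_, ⟨x, y, hx, rfl, hxy⟩, h'⟩ :=
            exists_lt_of_csInf_lt hne (show sInf B < 2 * sInf B by linarith)
          exact ⟨x, y, hx, by linarith, h', hxy⟩
      refine ⟨‖ψ x0‖, hψ x0 hx0, hx0P, Or.inr ?_, fun x y hx hxy => ?_⟩
      · by_contra h
        exact absurd hxy0 (not_le.2 (hex x0 y0 hx0 (not_le.1 h)))
      · by_contra hx00
        have h0 : 0 < ‖ψ x0‖ := by linarith [hψ x0 hx0]
        -- The determinant of two good approximations has absolute value below 1 / 4, so it vanishes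
        -- and the fractions agree. Then `x` has at least as good an error as `x0`, so its absolute
        -- value lies in `B` although it is less than the infimum.
        have hdet : x * y0 = x0 * y := by
          apply eq_of_norm_map_sub_lt_one ψ hψ
          have e : ψ (x * y0) - ψ (x0 * y) =
              ψ x0 * (ψ x * g - ψ y) - ψ x * (ψ x0 * g - ψ y0) := by
            simp only [map_mul]; ring
          rw [e]
          refine (norm_sub_le _ _).trans_lt ?_
          rw [norm_mul, norm_mul]
          have h1 : ‖ψ x0‖ * ‖ψ x * g - ψ y‖ < 1 / 8 := by
            calc _ < ‖ψ x0‖ * (1 / (8 * ‖ψ x0‖)) := by gcongr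
              _ = 1 / 8 := by field_simp
          have h2 : ‖ψ x‖ * ‖ψ x0 * g - ψ y0‖ ≤ 1 / 8 := by
            calc _ ≤ P * (1 / (8 * P)) := by gcongr; linarith
              _ = 1 / 8 := by field_simp
          linarith
        have hmem : ‖ψ x‖ ∈ B := by
          refine ⟨x, y, hx00, rfl, ?_⟩
          have e : ψ x0 * (ψ x * g - ψ y) = ψ x * (ψ x0 * g - ψ y0) := by
            have := congrArg ψ hdet
            simp only [map_mul] at this
            linear_combination this
          have e' : ‖ψ x0‖ * ‖ψ x * g - ψ y‖ = ‖ψ x‖ * ‖ψ x0 * g - ψ y0‖ := by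
            rw [← norm_mul, e, norm_mul]
          have : ‖ψ x0‖ * ‖ψ x * g - ψ y‖ ≤ ‖ψ x0‖ * ‖ψ x0 * g - ψ y0‖ := by
            rw [e']; gcongr; linarith
          exact (le_of_mul_le_mul_left this h0).trans hxy0
        have := csInf_le hbdd hmem
        linarith
    · push Not at hsmall
      refine ⟨P, hP, le_rfl, Or.inl rfl, fun x y hx hxy => ?_⟩
      by_contra h
      exact absurd (hsmall x y h (by linarith)) (not_lt.2 hxy.le)
  have hm0 : 0 < m := by linarith
  have hP0 : 0 < P := by linarith
  have hcard := card_le_of_separated S (fun v => ψ v.1) (fun v => ψ v.1 * g - ψ v.2)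
    (R₁ := P) (R₂ := ρ) (s₁ := m / 2) (s₂ := 1 / (8 * m)) (by positivity) (by positivity)
    hP0.le hρ.le (fun v hv => (hS v hv).1) (fun v hv => (hS v hv).2) (by
      intro v _ w _ h1 h2
      have e : ψ v.1 * g - ψ v.2 - (ψ w.1 * g - ψ w.2) = ψ (v.1 - w.1) * g - ψ (v.2 - w.2) := by
        simp only [map_sub]; ring
      rw [e] at h2
      rw [← map_sub] at h1
      have hx := hsep _ _ h1 h2
      refine Prod.ext (sub_eq_zero.1 hx) (sub_eq_zero.1 ?_)
      rw [hx, map_zero, zero_mul, zero_sub, norm_neg] at h2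
      by_contra hne
      have h3 := hψ _ hne
      have : 1 / (8 * m) ≤ 1 := by
        rw [div_le_one (by positivity)]; linarith
      linarith)
  refine hcard.trans ?_
  have e1 : 4 * P / (m / 2) = 8 * (P / m) := by field_simp; ring
  have e2 : 4 * ρ / (1 / (8 * m)) = 32 * (ρ * m) := by field_simp; ring
  rw [e1, e2, ← mul_pow]
  have hPm : 1 ≤ P / m := (one_le_div hm0).2 hmP
  -- The product of the two main terms is a multiple of ρP, independent of m. The cross terms are
  -- harmless because P / m ≥ 1 and either m = P or ρm ≥ 1 / 4; the excluded alternative of the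
  -- lemma is what could violate this.
  have hkey : (8 * (P / m) + 2) * (32 * (ρ * m) + 2) ≤ 1000 * (1 + ρ * P) := by
    have hρm : 0 < ρ * m := by positivity
    have hprod : P / m * (ρ * m) = ρ * P := by field_simp
    rcases hmρ with rfl | h
    · rw [div_self hP0.ne']
      nlinarith [mul_pos hρ hP0]
    · have h1 : 8 * (P / m) + 2 ≤ 10 * (P / m) := by linarith
      have h2 : 32 * (ρ * m) + 2 ≤ 40 * (ρ * m) := by linarith
      calc _ ≤ 10 * (P / m) * (40 * (ρ * m)) := by gcongr
        _ = 400 * (ρ * P) := by rw [← hprod]; ring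
        _ ≤ _ := by nlinarith [mul_pos hρ hP0]
  calc _ ≤ (1000 * (1 + ρ * P)) ^ 2 := by gcongr
    _ = _ := by ring

/-- If `g` is close enough to a fraction of small denominator, then only boundedly many reduced
fractions `r / q ^ k` are near `g`. -/
theorem card_le_of_approx [IsDomain R] [IsIntegrallyClosed R]
    (hψ : ∀ x : R, x ≠ 0 → 1 ≤ ‖ψ x‖) (g : ℂ) {P ρ : ℝ} {k : ℕ} (hk : k ≠ 0)
    (hP : 1 ≤ P) {x₀ y₀ : R} (hx₀ : x₀ ≠ 0) (hρ : ‖ψ x₀‖ * ρ < 1 / 4)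
    (h₀ : ‖ψ x₀ * g - ψ y₀‖ ≤ 1 / (8 * P)) (A : Finset (R × R))
    (hA : ∀ v ∈ A, v.1 ≠ 0 ∧ IsCoprime v.2 v.1 ∧ ‖ψ v.1‖ ^ k ≤ P ∧
      ‖ψ v.1 ^ k * g - ψ v.2‖ ≤ ρ) :
    (A.card : ℝ) ≤ 144 := by
  have hP0 : 0 < P := by linarith
  -- Again a determinant smaller than 1: every fraction in `A` equals y₀ / x₀, so the denominators
  -- differ only by units.
  have hprop : ∀ v ∈ A, x₀ * v.2 = y₀ * v.1 ^ k := by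
    intro v hv
    obtain ⟨-, -, h1, h2⟩ := hA v hv
    apply eq_of_norm_map_sub_lt_one ψ hψ
    have e : ψ (x₀ * v.2) - ψ (y₀ * v.1 ^ k) =
        ψ v.1 ^ k * (ψ x₀ * g - ψ y₀) - ψ x₀ * (ψ v.1 ^ k * g - ψ v.2) := by
      simp only [map_mul, map_pow]; ring
    rw [e]
    refine (norm_sub_le _ _).trans_lt ?_
    rw [norm_mul, norm_mul, norm_pow]
    have h3 : ‖ψ v.1‖ ^ k * ‖ψ x₀ * g - ψ y₀‖ ≤ 1 / 8 := by
      calc _ ≤ P * (1 / (8 * P)) := by gcongr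
        _ = 1 / 8 := by field_simp
    have h4 : ‖ψ x₀‖ * ‖ψ v.1 ^ k * g - ψ v.2‖ ≤ ‖ψ x₀‖ * ρ := by gcongr
    linarith
  have hcross : ∀ v ∈ A, ∀ w ∈ A, v.2 * w.1 ^ k = w.2 * v.1 ^ k := by
    intro v hv w hw
    apply mul_left_cancel₀ hx₀
    linear_combination w.1 ^ k * hprop v hv - v.1 ^ k * hprop w hw
  have hdvd : ∀ v ∈ A, ∀ w ∈ A, v.1 ∣ w.1 := by
    intro v hv w hw
    rw [← IsIntegrallyClosed.pow_dvd_pow_iff hk]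
    have h1 : v.1 ^ k ∣ v.2 * w.1 ^ k := ⟨w.2, by rw [hcross v hv w hw]; ring⟩
    exact ((hA v hv).2.1.symm.pow_left).dvd_of_dvd_mul_left h1
  rcases A.eq_empty_or_nonempty with rfl | ⟨v, hv⟩
  · simp
  have hv0 := (hA v hv).1
  choose! t ht using fun w hw => hdvd v hv w hw
  have hle : ∀ w ∈ A, ‖ψ (t w)‖ ≤ 1 := by
    intro w hw
    obtain ⟨s, hs⟩ := hdvd w hw v hv
    have h1 : t w * s = 1 := by
      apply mul_left_cancel₀ hv0
      rw [← mul_assoc, ← ht w hw, ← hs, mul_one]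
    have h2 : ‖ψ (t w)‖ * ‖ψ s‖ = 1 := by rw [← norm_mul, ← map_mul, h1]; simp
    have h3 := hψ s (by rintro rfl; simp at h1)
    nlinarith [norm_nonneg (ψ (t w))]
  have hcard := card_le_of_separated_one A (fun w => ψ (t w)) one_pos zero_le_one hle (by
    intro w hw w' hw' h
    have h1 : t w = t w' := eq_of_norm_map_sub_lt_one ψ hψ h
    have h2 : w.1 = w'.1 := by rw [ht w hw, ht w' hw', h1]
    refine Prod.ext h2 (mul_right_cancel₀ (pow_ne_zero k hv0) ?_)
    rw [← hcross v hv w hw, ← hcross v hv w' hw', h2])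
  norm_num at hcard
  exact_mod_cast hcard

/-- Reduced fractions near a given point, counted by determinants. -/
theorem card_le_of_det [IsDomain R] (hψ : ∀ x : R, x ≠ 0 → 1 ≤ ‖ψ x‖) (g : ℂ) {P ρ : ℝ}
    (hP : 0 ≤ P) (A : Finset (R × R))
    (hA : ∀ v ∈ A, v.1 ≠ 0 ∧ IsCoprime v.2 v.1 ∧ ‖ψ v.1‖ ≤ P ∧
      ‖ψ v.1 * g - ψ v.2‖ ≤ ρ)
    {M : ℝ} (hM : ∀ T : Finset R, (∀ t ∈ T, ‖ψ t‖ ≤ 2 * (P * ρ)) → (T.card : ℝ) ≤ M) :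
    (A.card : ℝ) ≤ 400 * M := by
  classical
  rcases A.eq_empty_or_nonempty with rfl | hne
  · simpa using hM ∅ (by simp)
  -- Determinants are taken against a fraction whose denominator is largest. A given determinant
  -- fixes w.1 modulo v.1, and by maximality two such w.1 differ by at most 2 ‖v.1‖; so each fibre
  -- injects into a 1-separated set in the disc of radius 2.
  obtain ⟨v, hv, hmax⟩ := A.exists_max_image (fun v => ‖ψ v.1‖) hne
  obtain ⟨hv0, hvc, hvP, hvρ⟩ := hA v hv
  set det : R × R → R := fun w => v.1 * w.2 - w.1 * v.2 with hdet
  have hfib : ∀ t ∈ A.image det, (A.filter (fun w => det w = t)).card ≤ 400 := by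
    intro t ht
    obtain ⟨u, hu, rfl⟩ := Finset.mem_image.1 ht
    have hdvd : ∀ w ∈ A.filter (fun w => det w = det u), v.1 ∣ w.1 - u.1 := by
      intro w hw
      have hw2 := (Finset.mem_filter.1 hw).2
      simp only [hdet] at hw2
      have : v.1 ∣ v.2 * (w.1 - u.1) := ⟨w.2 - u.2, by linear_combination -hw2⟩
      exact hvc.symm.dvd_of_dvd_mul_left this
    choose! l hl using hdvd
    have hcard := card_le_of_separated_one (A.filter (fun w => det w = det u))
      (fun w => ψ (l w)) one_pos (R := 2) (by norm_num) (by
        intro w hw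
        have h1 : ‖ψ v.1‖ * ‖ψ (l w)‖ ≤ ‖ψ v.1‖ * 2 := by
          rw [← norm_mul, ← map_mul, ← hl w hw, map_sub]
          have := norm_sub_le (ψ w.1) (ψ u.1)
          have := hmax w (Finset.mem_filter.1 hw).1
          have := hmax u hu
          linarith
        exact le_of_mul_le_mul_left h1 (by linarith [hψ _ hv0])) (by
        intro w hw w' hw' h
        have h1 : l w = l w' := eq_of_norm_map_sub_lt_one ψ hψ h
        have h2 : w.1 = w'.1 := by
          have := hl w hw
          rw [h1, ← hl w' hw'] at this
          exact sub_left_injective this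
        refine Prod.ext h2 (mul_left_cancel₀ hv0 ?_)
        have h3 := (Finset.mem_filter.1 hw).2.trans (Finset.mem_filter.1 hw').2.symm
        simp only [hdet, h2] at h3
        exact sub_left_injective h3)
    norm_num at hcard
    exact_mod_cast hcard
  have h1 := Finset.card_le_mul_card_image A 400 hfib
  have h2 := hM (A.image det) (by
    intro t ht
    obtain ⟨w, hw, rfl⟩ := Finset.mem_image.1 ht
    obtain ⟨hw0, hwc, hwP, hwρ⟩ := hA w hw
    have e : ψ (det w) = ψ w.1 * (ψ v.1 * g - ψ v.2) - ψ v.1 * (ψ w.1 * g - ψ w.2) := by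
      simp only [hdet, map_sub, map_mul]; ring
    rw [e]
    refine (norm_sub_le _ _).trans ?_
    rw [norm_mul, norm_mul]
    have h3 : ‖ψ w.1‖ * ‖ψ v.1 * g - ψ v.2‖ ≤ P * ρ := by gcongr
    have h4 : ‖ψ v.1‖ * ‖ψ w.1 * g - ψ w.2‖ ≤ P * ρ := by gcongr
    linarith)
  calc (A.card : ℝ) ≤ 400 * (A.image det).card := by exact_mod_cast h1
    _ ≤ _ := by gcongr

end DiscreteSubring

/-! ### Cubes and iterated differences -/

/-- The points `q` of `A` such that the cube based at `q` with edges in the list lies in `A`. -/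
def cubeBases {G : Type*} [Add G] [DecidableEq G] (A : Finset G) : List G → Finset G
  | [] => A
  | h :: l => cubeBases (A.filter (fun q => q + h ∈ A)) l

/-- Iterated difference of a function. -/
def iterDiff {G M : Type*} [Add G] [Sub M] (F : G → M) : List G → G → M
  | [] => F
  | h :: l => iterDiff (fun q => F (q + h) - F q) l

/-- The lists of given length with entries in a finset. -/
def listsOf {G : Type*} [DecidableEq G] (H : Finset G) : ℕ → Finset (List G)
  | 0 => {[]}
  | j + 1 => (H ×ˢ listsOf H j).image (fun p => p.1 :: p.2)

section Lists

variable {G : Type*} [DecidableEq G]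

theorem mem_listsOf {H : Finset G} {j : ℕ} {l : List G} :
    l ∈ listsOf H j ↔ l.length = j ∧ ∀ h ∈ l, h ∈ H := by
  induction j generalizing l with
  | zero => simp +contextual [listsOf, List.length_eq_zero_iff]
  | succ j ih =>
    cases l with
    | nil => simp [listsOf]
    | cons a l => simp [listsOf, ih]; tauto

theorem sum_listsOf_succ {M : Type*} [AddCommMonoid M] (H : Finset G) (j : ℕ) (f : List G → M) :
    ∑ l ∈ listsOf H (j + 1), f l = ∑ h ∈ H, ∑ l ∈ listsOf H j, f (h :: l) := by
  rw [listsOf, Finset.sum_image, Finset.sum_product]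
  rintro ⟨a, l⟩ - ⟨a', l'⟩ - h
  simpa using h

theorem card_listsOf (H : Finset G) (j : ℕ) : (listsOf H j).card = H.card ^ j := by
  induction j with
  | zero => simp [listsOf]
  | succ j ih =>
    rw [Finset.card_eq_sum_ones, sum_listsOf_succ]
    simp [ih, pow_succ']

end Lists

section Cubes

variable {G : Type*} [AddCommGroup G] [DecidableEq G]

/-- Ordered pairs of elements of `A` are sorted by their difference. -/
theorem sum_card_filter_add_mem (A H : Finset G) (hH : ∀ a ∈ A, ∀ b ∈ A, b - a ∈ H) :
    ∑ h ∈ H, (A.filter (fun q => q + h ∈ A)).card = A.card ^ 2 := by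
  simp only [Finset.card_filter]
  rw [Finset.sum_comm, pow_two, ← smul_eq_mul, ← Finset.sum_const]
  refine Finset.sum_congr rfl fun q hq => ?_
  rw [← Finset.card_filter]
  refine Finset.card_bij (fun h _ => q + h) (fun h hh => (Finset.mem_filter.1 hh).2)
    (fun _ _ _ _ h => add_left_cancel h) (fun b hb => ⟨b - q, ?_, by abel⟩)
  rw [Finset.mem_filter]
  exact ⟨hH q hq b hb, by simpa using hb⟩

/-- A set contains many cubes. -/
theorem card_pow_le_sum_cubeBases (H : Finset G) (j : ℕ) (A : Finset G)
    (hH : ∀ a ∈ A, ∀ b ∈ A, b - a ∈ H) :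
    (A.card : ℝ) ^ 2 ^ j ≤
      (H.card : ℝ) ^ (2 ^ j - j - 1) * ∑ l ∈ listsOf H j, ((cubeBases A l).card : ℝ) := by
  induction j generalizing A with
  | zero => simp [listsOf, cubeBases]
  | succ j ih =>
    rcases A.eq_empty_or_nonempty with rfl | ⟨a, ha⟩
    · simp only [Finset.card_empty, Nat.cast_zero]
      rw [zero_pow (by positivity)]
      positivity
    have hH0 : 0 < (H.card : ℝ) := by
      exact_mod_cast Finset.card_pos.2 ⟨_, hH a ha a ha⟩
    have hj : j + 1 ≤ 2 ^ j := Nat.lt_two_pow_self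
    -- Hölder over the first edge `h`; the induction hypothesis is then applied to each set of
    -- points `q` with `q` and `q + h` both in `A`.
    have h1 := pow_sum_div_card_le_sum_pow (s := H)
      (f := fun h => ((A.filter (fun q => q + h ∈ A)).card : ℝ)) (fun _ _ => by positivity)
      (2 ^ j - 1)
    rw [div_le_iff₀ (by positivity), Nat.sub_add_cancel Nat.one_le_two_pow, ← Nat.cast_sum,
      sum_card_filter_add_mem A H hH] at h1
    have h2 : ∑ h ∈ H, ((A.filter (fun q => q + h ∈ A)).card : ℝ) ^ 2 ^ j ≤
        ∑ h ∈ H, (H.card : ℝ) ^ (2 ^ j - j - 1) *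
          ∑ l ∈ listsOf H j, ((cubeBases A (h :: l)).card : ℝ) :=
      Finset.sum_le_sum fun h _ => ih _ fun a ha b hb =>
        hH a (Finset.mem_filter.1 ha).1 b (Finset.mem_filter.1 hb).1
    rw [← Finset.mul_sum, ← sum_listsOf_succ H j (fun l => ((cubeBases A l).card : ℝ))] at h2
    have e : 2 ^ (j + 1) - (j + 1) - 1 = (2 ^ j - j - 1) + (2 ^ j - 1) := by
      rw [pow_succ]; omega
    calc (A.card : ℝ) ^ 2 ^ (j + 1) = ((A.card ^ 2 : ℕ) : ℝ) ^ 2 ^ j := by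
          push_cast; rw [← pow_mul, pow_succ']
      _ ≤ _ := h1
      _ ≤ _ := mul_le_mul_of_nonneg_right h2 (by positivity)
      _ = _ := by rw [e, pow_add]; ring

theorem cubeBases_subset (l : List G) (A : Finset G) : cubeBases A l ⊆ A := by
  induction l generalizing A with
  | nil => exact subset_rfl
  | cons h l ih => exact (ih _).trans (Finset.filter_subset _ _)

theorem norm_iterDiff_le {E : Type*} [SeminormedAddCommGroup E] (l : List G) (A : Finset G)
    (F : G → E) {ρ : ℝ} (hF : ∀ q ∈ A, ‖F q‖ ≤ ρ) {q : G} (hq : q ∈ cubeBases A l) :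
    ‖iterDiff F l q‖ ≤ 2 ^ l.length * ρ := by
  induction l generalizing A F ρ with
  | nil => simpa [iterDiff] using hF q hq
  | cons h l ih =>
    have := ih (A.filter (fun q => q + h ∈ A)) (fun q => F (q + h) - F q) (ρ := 2 * ρ)
      (fun q hq => by
        obtain ⟨h1, h2⟩ := Finset.mem_filter.1 hq
        have := norm_sub_le (F (q + h)) (F q)
        have := hF _ h1
        have := hF _ h2
        linarith) hq
    rw [List.length_cons, pow_succ, mul_assoc]
    exact this

end Cubes

section Differences

variable {G : Type*} [AddCommGroup G]

theorem iterDiff_map {M M' : Type*} [AddGroup M] [AddGroup M'] (f : M →+ M') (l : List G)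
    (F : G → M) (q : G) : iterDiff (fun q => f (F q)) l q = f (iterDiff F l q) := by
  induction l generalizing F with
  | nil => rfl
  | cons h l ih => simp only [iterDiff]; rw [← ih]; simp only [map_sub]

theorem iterDiff_sub {M : Type*} [AddCommGroup M] (l : List G)
    (F F' : G → M) (q : G) :
    iterDiff (fun q => F q - F' q) l q = iterDiff F l q - iterDiff F' l q := by
  induction l generalizing F F' with
  | nil => rfl
  | cons h l ih =>
    simp only [iterDiff]
    rw [← ih]
    congr 1
    ext q
    abel

end Differences

/-! ### Weyl differencing of polynomials -/

section Polynomials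

open Polynomial

variable {R : Type*} [CommRing R]

theorem exists_pow_succ_diff (i : ℕ) (h : R) : ∃ p : R[X], p.natDegree ≤ i ∧ p.coeff i = i + 1 ∧
    ∀ q, (q + h) ^ (i + 1) - q ^ (i + 1) = h * p.eval q := by
  induction i with
  | zero => exact ⟨1, by simp, by simp, fun q => by simp⟩
  | succ i ih =>
    obtain ⟨p, hdeg, hcoeff, hp⟩ := ih
    -- The recursion comes from (q + h) ^ (i + 2) - q ^ (i + 2) = (q + h) ((q + h) ^ (i + 1) - q ^
    -- (i + 1)) + h q ^ (i + 1).
    refine ⟨X * p + C h * p + X ^ (i + 1), ?_, ?_, fun q => ?_⟩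
    · refine natDegree_add_le_of_degree_le (natDegree_add_le_of_degree_le ?_ ?_)
        (natDegree_X_pow_le _)
      · exact natDegree_mul_le.trans (by have := natDegree_X_le (R := R); omega)
      · exact (natDegree_C_mul_le _ _).trans (by omega)
    · rw [coeff_add, coeff_add, coeff_X_mul, hcoeff, coeff_C_mul,
        coeff_eq_zero_of_natDegree_lt (by omega), coeff_X_pow]
      simp
    · simp only [eval_add, eval_mul, eval_X, eval_C, eval_pow]
      linear_combination (q + h) * hp q

theorem exists_polynomial_diff (j : ℕ) (p : R[X]) (hp : p.natDegree ≤ j + 1) (h : R) :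
    ∃ p' : R[X], p'.natDegree ≤ j ∧ p'.coeff j = (j + 1) * p.coeff (j + 1) ∧
      ∀ q, p.eval (q + h) - p.eval q = h * p'.eval q := by
  choose f hdeg hcoeff hf using fun i => exists_pow_succ_diff i h
  refine ⟨∑ i ∈ Finset.range (j + 1), C (p.coeff (i + 1)) * f i, ?_, ?_, fun q => ?_⟩
  · refine natDegree_sum_le_of_forall_le _ _ fun i hi => ?_
    have := Finset.mem_range.1 hi
    exact (natDegree_C_mul_le _ _).trans ((hdeg i).trans (by omega))
  · rw [finsetSum_coeff, Finset.sum_range_succ, Finset.sum_eq_zero, coeff_C_mul, hcoeff]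
    · ring
    · intro i hi
      have := Finset.mem_range.1 hi
      rw [coeff_C_mul, coeff_eq_zero_of_natDegree_lt ((hdeg i).trans_lt this), mul_zero]
  · have hlt : p.natDegree < j + 2 := by omega
    rw [eval_eq_sum_range' hlt, eval_eq_sum_range' hlt, ← Finset.sum_sub_distrib,
      Finset.sum_range_succ', eval_finsetSum, Finset.mul_sum]
    simp only [pow_zero, sub_self, add_zero]
    refine Finset.sum_congr rfl fun i _ => ?_
    rw [eval_mul, eval_C]
    linear_combination p.coeff (i + 1) * hf i q

/-- Weyl differencing: all but one of the possible differences of a polynomial is a product of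
the increments and a linear polynomial. -/
theorem exists_iterDiff_eval (l : List R) (p : R[X]) (hp : p.natDegree ≤ l.length + 1) :
    ∃ c, ∀ q, iterDiff (fun q => p.eval q) l q =
      l.prod * ((l.length + 1).factorial * p.coeff (l.length + 1) * q + c) := by
  induction l generalizing p with
  | nil =>
    refine ⟨p.coeff 0, fun q => ?_⟩
    have hlt : p.natDegree < 2 := by simpa [Nat.lt_succ_iff] using hp
    simp [iterDiff, eval_eq_sum_range' hlt, Finset.sum_range_succ, add_comm]
  | cons h l ih =>
    obtain ⟨p', hdeg, hcoeff, hp'⟩ := exists_polynomial_diff _ p hp h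
    obtain ⟨c, hc⟩ := ih p' hdeg
    refine ⟨c, fun q => ?_⟩
    simp only [iterDiff, hp']
    have e : iterDiff (fun q => h * p'.eval q) l q = h * iterDiff (fun q => p'.eval q) l q :=
      iterDiff_map (AddMonoidHom.mulLeft h) l (fun q => p'.eval q) q
    rw [e, hc]
    simp only [List.prod_cons, List.length_cons] at hcoeff ⊢
    rw [hcoeff, Nat.factorial_succ (l.length + 1)]
    push_cast
    ring

end Polynomials

/-! ### The combinatorial Weyl inequality -/

section Weyl

variable {R : Type*} [CommRing R] [IsDomain R] [CharZero R] [DecidableEq R] (ψ : R →+* ℂ)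

/-- In a domain one of the j entries must be 0, which saves a factor `H.card`. The saving is put on
the left to avoid dividing by a possibly zero cardinality. -/
theorem card_listsOf_prod_eq_zero (H : Finset R) (j : ℕ) :
    ((listsOf H j).filter (fun l => l.prod = 0)).card * H.card ≤ j * H.card ^ j := by
  induction j with
  | zero => simp [listsOf, Finset.filter_singleton]
  | succ j ih =>
    have h1 : ((listsOf H (j + 1)).filter (fun l => l.prod = 0)).card ≤
        H.card ^ j + H.card * ((listsOf H j).filter (fun l => l.prod = 0)).card := by
      have hsub : (listsOf H (j + 1)).filter (fun l => l.prod = 0) ⊆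
          (listsOf H j).image (fun l => 0 :: l) ∪
          (H ×ˢ (listsOf H j).filter (fun l => l.prod = 0)).image (fun p => p.1 :: p.2) := by
        intro l hl
        obtain ⟨hl1, hl2⟩ := Finset.mem_filter.1 hl
        obtain ⟨⟨a, l'⟩, hp, rfl⟩ := Finset.mem_image.1 hl1
        obtain ⟨ha, hl'⟩ := Finset.mem_product.1 hp
        rw [List.prod_cons, mul_eq_zero] at hl2
        rcases hl2 with h | h
        · exact Finset.mem_union_left _ (Finset.mem_image.2 ⟨l', hl', by simpa using h.symm⟩)
        · exact Finset.mem_union_right _ (Finset.mem_image.2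
            ⟨(a, l'), Finset.mem_product.2 ⟨ha, Finset.mem_filter.2 ⟨hl', h⟩⟩, rfl⟩)
      refine (Finset.card_le_card hsub).trans ((Finset.card_union_le _ _).trans ?_)
      refine Nat.add_le_add (Finset.card_image_le.trans (card_listsOf H j).le)
        (Finset.card_image_le.trans (Finset.card_product _ _).le)
    calc _ ≤ (H.card ^ j + H.card * ((listsOf H j).filter (fun l => l.prod = 0)).card) * H.card :=
          Nat.mul_le_mul_right _ h1
      _ = H.card ^ (j + 1) +
          H.card * (((listsOf H j).filter (fun l => l.prod = 0)).card * H.card) := by ring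
      _ ≤ H.card ^ (j + 1) + H.card * (j * H.card ^ j) := by gcongr
      _ = _ := by ring

/-- Combinatorial Weyl inequality: if `q ^ (j + 1) * g` is close to a lattice point for all `q` in
`A`, then `A` is small, in terms of the number of solutions of a linear problem. -/
theorem card_pow_le_of_pow_mul_near (g : ℂ) (j : ℕ) {P ρ M : ℝ} {D : ℕ} (A H : Finset R)
    (r : R → R) (hH : ∀ a ∈ A, ∀ b ∈ A, b - a ∈ H) (hP : ∀ q ∈ A, ‖ψ q‖ ^ (j + 1) ≤ P)
    (hr : ∀ q ∈ A, ‖ψ q ^ (j + 1) * g - ψ (r q)‖ ≤ ρ)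
    (hD : ∀ x : R, x ≠ 0 → ‖ψ x‖ ≤ 2 ^ j * P → ∃ S : Finset R, (∀ h, h ∣ x → h ∈ S) ∧ S.card ≤ D)
    (hM : ∀ S : Finset (R × R),
      (∀ v ∈ S, ‖ψ v.1‖ ≤ 2 ^ j * P ∧ ‖ψ v.1 * g - ψ v.2‖ ≤ 2 ^ j * ρ) → (S.card : ℝ) ≤ M) :
    (A.card : ℝ) ^ 2 ^ j ≤ (H.card : ℝ) ^ (2 ^ j - j - 1) *
      ((j + 1) * (H.card : ℝ) ^ j + (D : ℝ) ^ (j + 1) * M) := by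
  refine (card_pow_le_sum_cubeBases H j A hH).trans (mul_le_mul_of_nonneg_left ?_ (by positivity))
  have hAH : A.card ≤ H.card := by
    rcases A.eq_empty_or_nonempty with rfl | ⟨a, ha⟩
    · simp
    · exact Finset.card_le_card_of_injOn (fun b => b - a) (fun b hb => hH a ha b hb)
        (fun _ _ _ _ h => sub_left_injective h)
  set pw : R → R := fun q => q ^ (j + 1) with hpw
  have hlin : ∀ l : List R, ∃ c, l.length = j → ∀ q,
      iterDiff pw l q = l.prod * ((j + 1).factorial * q + c) := by
    intro l
    by_cases hl : l.length = j
    · obtain ⟨c, hc⟩ := exists_iterDiff_eval l (Polynomial.X ^ (j + 1)) (by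
        rw [hl]; exact Polynomial.natDegree_X_pow_le _)
      refine ⟨c, fun _ q => ?_⟩
      have := hc q
      simpa [hl, hpw] using this
    · exact ⟨0, fun h => absurd h hl⟩
  choose c hc using hlin
  have hfac : ((j + 1).factorial : R) ≠ 0 := Nat.cast_ne_zero.2 (Nat.factorial_ne_zero _)
  set T : Finset (Σ _ : List R, R) := (listsOf H j).sigma (fun l => cubeBases A l) with hT
  have hTmem : ∀ t ∈ T, t.1 ∈ listsOf H j ∧ t.2 ∈ cubeBases A t.1 := fun t ht => by
    simpa [hT] using ht
  have hcardT : ∑ l ∈ listsOf H j, ((cubeBases A l).card : ℝ) = T.card := by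
    rw [hT, Finset.card_sigma]; push_cast; rfl
  rw [hcardT]
  set X : (Σ _ : List R, R) → R := fun t => iterDiff pw t.1 t.2 with hX
  have hXT : ∀ t ∈ T, X t = t.1.prod * ((j + 1).factorial * t.2 + c t.1) := fun t ht =>
    hc _ (mem_listsOf.1 (hTmem t ht).1).1 _
  -- The degenerate cubes.
  have hzero : (T.filter (fun t => X t = 0)).card ≤ (j + 1) * H.card ^ j := by
    have hsub : T.filter (fun t => X t = 0) ⊆
        ((listsOf H j).filter (fun l => l.prod = 0)).sigma (fun l => cubeBases A l) ∪
        T.filter (fun t => (j + 1).factorial * t.2 + c t.1 = 0) := by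
      intro t ht
      obtain ⟨ht1, ht2⟩ := Finset.mem_filter.1 ht
      rw [hXT t ht1, mul_eq_zero] at ht2
      rcases ht2 with h | h
      · refine Finset.mem_union_left _ (Finset.mem_sigma.2 ⟨Finset.mem_filter.2 ⟨?_, h⟩, ?_⟩)
        · exact (hTmem t ht1).1
        · exact (hTmem t ht1).2
      · exact Finset.mem_union_right _ (Finset.mem_filter.2 ⟨ht1, h⟩)
    have h1 : (((listsOf H j).filter (fun l => l.prod = 0)).sigma
        (fun l => cubeBases A l)).card ≤ j * H.card ^ j := by
      rw [Finset.card_sigma]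
      calc _ ≤ ∑ l ∈ (listsOf H j).filter (fun l => l.prod = 0), H.card :=
            Finset.sum_le_sum fun l _ => (Finset.card_le_card (cubeBases_subset l A)).trans hAH
        _ = _ := by rw [Finset.sum_const, smul_eq_mul]
        _ ≤ _ := card_listsOf_prod_eq_zero H j
    have h2 : (T.filter (fun t => (j + 1).factorial * t.2 + c t.1 = 0)).card ≤ H.card ^ j := by
      rw [← card_listsOf]
      refine Finset.card_le_card_of_injOn Sigma.fst
        (fun t ht => (hTmem t (Finset.mem_filter.1 ht).1).1) ?_
      rintro ⟨l, q⟩ ht ⟨l', q'⟩ ht' (rfl : l = l')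
      have e1 := (Finset.mem_filter.1 ht).2
      have e2 := (Finset.mem_filter.1 ht').2
      simp only at e1 e2
      have : q = q' := mul_left_cancel₀ hfac (by linear_combination e1 - e2)
      rw [this]
    calc _ ≤ _ := Finset.card_le_card hsub
      _ ≤ _ := Finset.card_union_le _ _
      _ ≤ j * H.card ^ j + H.card ^ j := Nat.add_le_add h1 h2
      _ = _ := by ring
  -- The other cubes.
  have hbound : ∀ t ∈ T, ‖ψ (X t)‖ ≤ 2 ^ j * P ∧
      ‖ψ (X t) * g - ψ (iterDiff r t.1 t.2)‖ ≤ 2 ^ j * ρ := by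
    intro t ht
    obtain ⟨ht1, ht2⟩ := hTmem t ht
    have hlen := (mem_listsOf.1 ht1).1
    constructor
    · have := norm_iterDiff_le t.1 A (fun q => ψ (pw q)) (ρ := P)
        (fun q hq => by simpa [hpw] using hP q hq) ht2
      rw [hlen] at this
      have e : iterDiff (fun q => ψ (pw q)) t.1 t.2 = ψ (X t) :=
        iterDiff_map ψ.toAddMonoidHom t.1 pw t.2
      rwa [e] at this
    · have := norm_iterDiff_le t.1 A (fun q => ψ (pw q) * g - ψ (r q)) (ρ := ρ)
        (fun q hq => by simpa [hpw] using hr q hq) ht2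
      have e1 : iterDiff (fun q => ψ (pw q) * g) t.1 t.2 = ψ (X t) * g :=
        iterDiff_map ((AddMonoidHom.mulRight g).comp ψ.toAddMonoidHom) t.1 pw t.2
      have e2 : iterDiff (fun q => ψ (r q)) t.1 t.2 = ψ (iterDiff r t.1 t.2) :=
        iterDiff_map ψ.toAddMonoidHom t.1 r t.2
      rwa [hlen, iterDiff_sub, e1, e2] at this
  set Φ : (Σ _ : List R, R) → R × R := fun t => (X t, iterDiff r t.1 t.2) with hΦ
  -- All edges of the cube and the linear factor divide the nonzero element `X u`, so each of these
  -- j + 1 quantities has at most D values; together they determine the cube because (j + 1)! is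
  -- nonzero.
  have hfib : ∀ v ∈ (T.filter (fun t => ¬ X t = 0)).image Φ,
      ((T.filter (fun t => ¬ X t = 0)).filter (fun t => Φ t = v)).card ≤ D ^ (j + 1) := by
    intro v hv
    obtain ⟨u, hu, rfl⟩ := Finset.mem_image.1 hv
    obtain ⟨hu1, hu2⟩ := Finset.mem_filter.1 hu
    obtain ⟨S, hS, hSD⟩ := hD (X u) hu2 (hbound u hu1).1
    have hmaps : ∀ t ∈ (T.filter (fun t => ¬ X t = 0)).filter (fun t => Φ t = Φ u),
        (t.1, ((j + 1).factorial : R) * t.2 + c t.1) ∈ listsOf S j ×ˢ S := by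
      intro t ht
      obtain ⟨ht1, ht2⟩ := Finset.mem_filter.1 ht
      have htT := (Finset.mem_filter.1 ht1).1
      have hXtu : X u = t.1.prod * ((j + 1).factorial * t.2 + c t.1) := by
        rw [← hXT t htT]; exact (congrArg Prod.fst ht2).symm
      refine Finset.mem_product.2 ⟨mem_listsOf.2 ⟨(mem_listsOf.1 (hTmem t htT).1).1, ?_⟩, ?_⟩
      · intro h hh
        exact hS h (hXtu ▸ (List.dvd_prod hh).mul_right _)
      · exact hS _ (hXtu ▸ dvd_mul_left _ _)
    calc _ ≤ (listsOf S j ×ˢ S).card := by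
          refine Finset.card_le_card_of_injOn _ hmaps ?_
          rintro ⟨l, q⟩ - ⟨l', q'⟩ - h
          simp only [Prod.mk.injEq] at h
          obtain ⟨rfl, h⟩ := h
          have : q = q' := mul_left_cancel₀ hfac (by linear_combination h)
          rw [this]
      _ = S.card ^ (j + 1) := by rw [Finset.card_product, card_listsOf, pow_succ]
      _ ≤ _ := Nat.pow_le_pow_left hSD _
  have hnz := Finset.card_le_mul_card_image _ _ hfib
  have himg := hM ((T.filter (fun t => ¬ X t = 0)).image Φ) (by
    intro v hv
    obtain ⟨u, hu, rfl⟩ := Finset.mem_image.1 hv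
    exact hbound u (Finset.mem_filter.1 hu).1)
  rw [← Finset.card_filter_add_card_filter_not (s := T) (fun t => X t = 0), Nat.cast_add]
  have hz' : ((T.filter (fun t => X t = 0)).card : ℝ) ≤ (j + 1) * (H.card : ℝ) ^ j := by
    exact_mod_cast hzero
  have hn' : ((T.filter (fun t => ¬ X t = 0)).card : ℝ) ≤
      (D : ℝ) ^ (j + 1) * ((T.filter (fun t => ¬ X t = 0)).image Φ).card := by
    exact_mod_cast hnz
  refine add_le_add hz' (hn'.trans ?_)
  gcongr

end Weyl

/-! ### Integral bases and lattice points in quadratic fields -/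

section QuadraticExtension

variable {K : Type*} [Field K] [NumberField K] [Algebra.IsQuadraticExtension ℚ K]

theorem finrank_int_eq_two : Module.finrank ℤ (𝓞 K) = 2 := by
  rw [RingOfIntegers.rank, Algebra.IsQuadraticExtension.finrank_eq_two ℚ K]

theorem norm_intCast (n : ℤ) : Algebra.norm ℤ (n : 𝓞 K) = n ^ 2 := by
  have := Algebra.norm_algebraMap (R := ℤ) (S := 𝓞 K) n
  rwa [finrank_int_eq_two, algebraMap_int_eq, eq_intCast] at this

/-- The vector 1 is primitive in the lattice 𝓞 K, so it extends to a basis. -/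
theorem exists_one_generator : ∃ ω : 𝓞 K, ∀ z : 𝓞 K, ∃ x y : ℤ, z = x + y * ω := by
  have hcard : Fintype.card (Module.Free.ChooseBasisIndex ℤ (𝓞 K)) = Fintype.card (Fin 2) := by
    rw [← Module.finrank_eq_card_chooseBasisIndex, finrank_int_eq_two, Fintype.card_fin]
  set b := (Module.Free.chooseBasis ℤ (𝓞 K)).reindex (Fintype.equivOfCardEq hcard) with hb
  have hrep : ∀ z : 𝓞 K, z = (b.repr z 0 : 𝓞 K) * b 0 + (b.repr z 1 : 𝓞 K) * b 1 := by
    intro z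
    have := b.sum_repr z
    rw [Fin.sum_univ_two] at this
    rw [← zsmul_eq_mul, ← zsmul_eq_mul]
    exact this.symm
  obtain ⟨x, y, hxy⟩ : ∃ x y : ℤ, (1 : 𝓞 K) = x * b 0 + y * b 1 := ⟨_, _, hrep 1⟩
  have hcop : IsCoprime x y := by
    rw [Int.isCoprime_iff_gcd_eq_one]
    obtain ⟨x', hx'⟩ := Int.gcd_dvd_left x y
    obtain ⟨y', hy'⟩ := Int.gcd_dvd_right x y
    -- An integer dividing 1 in 𝓞 K is a unit, because its square, the norm, is one.
    have h1 : (1 : 𝓞 K) = ((x.gcd y : ℤ) : 𝓞 K) * (x' * b 0 + y' * b 1) := by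
      rw [hxy]
      nth_rewrite 1 [hx']
      nth_rewrite 2 [hy']
      push_cast
      ring
    have h2 := congrArg (Algebra.norm ℤ) h1
    rw [map_one, map_mul, norm_intCast] at h2
    have h3 : IsUnit ((x.gcd y : ℤ) ^ 2) := IsUnit.of_mul_eq_one _ h2.symm
    rw [isUnit_pow_iff two_ne_zero, Int.isUnit_iff] at h3
    omega
  obtain ⟨u, v, huv⟩ := hcop
  have huv' : (u : 𝓞 K) * x + v * y = 1 := by exact_mod_cast congrArg (Int.cast (R := 𝓞 K)) huv
  -- With ux + vy = 1, the matrix expressing 1 and this element in the basis b has determinant 1.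
  refine ⟨-v * b 0 + u * b 1, fun z => ?_⟩
  refine ⟨b.repr z 0 * u + b.repr z 1 * v, b.repr z 1 * x - b.repr z 0 * y, ?_⟩
  conv_lhs => rw [hrep z]
  set p := b.repr z 0
  set q := b.repr z 1
  push_cast
  linear_combination (-(p : 𝓞 K) * b 0 - q * b 1) * huv' - ((p : 𝓞 K) * u + q * v) * hxy

end QuadraticExtension

section Quadratic

variable {K : Type*} [Field K] [NumberField K]
  [Algebra.IsQuadraticExtension ℚ K] [IsTotallyComplex K] (φ : K →+* ℂ)

/-- The restriction of a complex embedding to the ring of integers. -/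
noncomputable abbrev intEmb : 𝓞 K →+* ℂ := φ.comp (algebraMap (𝓞 K) K)

theorem one_le_norm_intEmb {x : 𝓞 K} (hx : x ≠ 0) : 1 ≤ ‖intEmb φ x‖ := by
  have h := norm_eq_sq_norm K φ x
  have h0 : Algebra.norm ℤ x ≠ 0 := Algebra.norm_ne_zero_iff.2 hx
  have h1 : (0 : ℝ) ≤ (Algebra.norm ℤ x : ℤ) := by rw [h]; positivity
  have h2 : (1 : ℤ) ≤ Algebra.norm ℤ x := by
    have : (0 : ℤ) ≤ Algebra.norm ℤ x := by exact_mod_cast h1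
    omega
  have h3 : (1 : ℝ) ≤ (Algebra.norm ℤ x : ℤ) := by exact_mod_cast h2
  rw [h] at h3
  change 1 ≤ ‖φ x‖
  nlinarith [norm_nonneg (φ x)]

theorem mem_normBall_iff {X : ℝ} {n : 𝓞 K} : n ∈ normBall K X ↔ ‖intEmb φ n‖ ^ 2 ≤ X := by
  rw [normBall, Set.Finite.mem_toFinset, Set.mem_ofPred_eq, norm_eq_sq_norm K φ]
  rfl

theorem mem_nonzeroNormBall_iff {X : ℝ} {n : 𝓞 K} :
    n ∈ nonzeroNormBall K X ↔ ‖intEmb φ n‖ ^ 2 ≤ X ∧ n ≠ 0 := by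
  rw [nonzeroNormBall, Set.Finite.mem_toFinset, Set.mem_sdiff, Set.mem_ofPred_eq,
    norm_eq_sq_norm K φ, Set.mem_singleton_iff]
  rfl

theorem intCast_trace (x : 𝓞 K) :
    ((Algebra.trace ℤ (𝓞 K) x : ℤ) : ℂ) = intEmb φ x + starRingEnd ℂ (intEmb φ x) := by
  classical
  have hne : φ ≠ ComplexEmbedding.conjugate φ := fun h =>
    (InfinitePlace.isComplex_mk_iff.mp (IsTotallyComplex.isComplex (InfinitePlace.mk φ))) h.symm
  have hne' : φ.toRatAlgHom ≠ (ComplexEmbedding.conjugate φ).toRatAlgHom := fun h =>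
    hne (RingHom.ext fun x => by simpa using DFunLike.congr_fun h x)
  have huniv : (Finset.univ : Finset (K →ₐ[ℚ] ℂ)) =
      {φ.toRatAlgHom, (ComplexEmbedding.conjugate φ).toRatAlgHom} := by
    symm
    apply Finset.eq_univ_of_card
    rw [AlgHom.card, Algebra.IsQuadraticExtension.finrank_eq_two ℚ K, Finset.card_pair hne']
  have h1 := trace_eq_sum_embeddings (K := ℚ) (L := K) ℂ (x := (x : K))
  rw [huniv, Finset.sum_pair hne', ← Algebra.coe_trace_int] at h1
  simp only [RingHom.toRatAlgHom_apply, ComplexEmbedding.conjugate_coe_eq] at h1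
  rw [show intEmb φ x = φ x from rfl, ← h1]
  simp

/-- The trace form in the basis 1, ω has determinant (w - w̄) ^ 2, where w is the image of ω, and w
- w̄ = 2i Im w. -/
theorem discr_eq_of_generator {ω : 𝓞 K} (hω : ∀ z : 𝓞 K, ∃ x y : ℤ, z = x + y * ω) :
    -(discr K : ℝ) = (2 * (intEmb φ ω).im) ^ 2 := by
  classical
  set b : Module.Basis (Fin 2) ℤ (𝓞 K) := basisOfTopLeSpanOfCardEqFinrank ![1, ω] (by
    intro z _
    obtain ⟨x, y, rfl⟩ := hω z
    rw [← zsmul_eq_mul, ← zsmul_one x]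
    exact add_mem (Submodule.smul_mem _ _ (Submodule.subset_span ⟨0, rfl⟩))
      (Submodule.smul_mem _ _ (Submodule.subset_span ⟨1, rfl⟩)))
    (by rw [finrank_int_eq_two, Fintype.card_fin]) with hb
  have h := NumberField.discr_eq_discr K b
  rw [Algebra.discr_def, Matrix.det_fin_two] at h
  have hb' : (b : Fin 2 → 𝓞 K) = ![1, ω] := by
    rw [hb]; exact coe_basisOfTopLeSpanOfCardEqFinrank _ _ _
  simp only [hb', Algebra.traceMatrix_apply, Algebra.traceForm_apply, Matrix.cons_val_zero,
    Matrix.cons_val_one, one_mul, mul_one] at h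
  have h2 := congrArg (Int.cast (R := ℂ)) h
  push_cast at h2
  rw [intCast_trace φ, intCast_trace φ, intCast_trace φ, map_one, map_one, map_mul, map_mul] at h2
  set w := intEmb φ ω
  have hw : w - starRingEnd ℂ w = (2 * w.im : ℝ) * Complex.I := Complex.sub_conj w
  have h3 : -(discr K : ℂ) = (((2 * w.im) ^ 2 : ℝ) : ℂ) := by
    rw [← h2]
    have : (w - starRingEnd ℂ w) ^ 2 = -(((2 * w.im) ^ 2 : ℝ) : ℂ) := by
      rw [hw, mul_pow, Complex.I_sq]; push_cast; ring
    linear_combination -this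
  exact_mod_cast h3

/-- The square root of the absolute value of the discriminant of an imaginary quadratic field. -/
noncomputable def sqrtDisc (K : Type*) [Field K] [NumberField K] : ℝ := Real.sqrt (-(discr K : ℝ))

/-- A reduced integral basis `1, ω`. -/
theorem exists_reduced_generator : ∃ ω : 𝓞 K, (∀ z : 𝓞 K, ∃ x y : ℤ, z = x + y * ω) ∧
    |(intEmb φ ω).re| ≤ 1 / 2 ∧ 2 * |(intEmb φ ω).im| = sqrtDisc K := by
  obtain ⟨ω, hω⟩ := exists_one_generator (K := K)
  have hω' : ∀ z : 𝓞 K, ∃ x y : ℤ, z = x + y * (ω - (round (intEmb φ ω).re : ℤ)) := by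
    intro z
    obtain ⟨x, y, rfl⟩ := hω z
    exact ⟨x + y * round (intEmb φ ω).re, y, by push_cast; ring⟩
  refine ⟨_, hω', ?_, ?_⟩
  · rw [map_sub, map_intCast, Complex.sub_re, Complex.intCast_re]
    exact abs_sub_round _
  · rw [sqrtDisc, discr_eq_of_generator φ hω', Real.sqrt_sq_eq_abs, abs_mul]
    simp

variable (K) in
theorem one_le_sqrtDisc : 1 ≤ sqrtDisc K := by
  obtain ⟨φ⟩ : Nonempty (K →+* ℂ) := inferInstance
  obtain ⟨ω, hω⟩ := exists_one_generator (K := K)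
  have h1 := discr_eq_of_generator φ hω
  have h2 : discr K ≠ 0 := discr_ne_zero K
  have h3 : (0 : ℝ) ≤ -(discr K : ℝ) := by rw [h1]; positivity
  have h4 : (1 : ℤ) ≤ -discr K := by
    have : (0 : ℤ) ≤ -discr K := by exact_mod_cast h3
    omega
  rw [sqrtDisc, Real.one_le_sqrt]
  exact_mod_cast h4

/-- Lattice points in a disc. -/
theorem card_le_of_norm_intEmb_le {T : Finset (𝓞 K)} {r : ℝ} (hr : 0 ≤ r)
    (hT : ∀ t ∈ T, ‖intEmb φ t‖ ≤ r) :
    (T.card : ℝ) ≤ 100 * (1 + r + r ^ 2 / sqrtDisc K) := by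
  obtain ⟨ω, hω, hre, him⟩ := exists_reduced_generator φ
  have hd := one_le_sqrtDisc K
  have hd0 : 0 < sqrtDisc K := by linarith
  choose x y hxy using hω
  -- The imaginary part alone controls y, since |Im ω| = d / 2. The real part then controls x. For r
  -- much smaller than d only y = 0 survives, whence the term r in the bound.
  have hy : ∀ t ∈ T, |(y t : ℝ)| ≤ 2 * r / sqrtDisc K := by
    intro t ht
    have h1 : (intEmb φ t).im = y t * (intEmb φ ω).im := by
      conv_lhs => rw [hxy t]
      simp [Complex.add_im, Complex.mul_im]
    have h2 := (Complex.abs_im_le_norm (intEmb φ t)).trans (hT t ht)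
    rw [h1, abs_mul] at h2
    rw [le_div_iff₀ hd0, ← him]
    linarith
  have hx : ∀ t ∈ T, |(x t : ℝ)| ≤ 2 * r := by
    intro t ht
    have h1 : (intEmb φ t).re = x t + y t * (intEmb φ ω).re := by
      conv_lhs => rw [hxy t]
      simp [Complex.add_re, Complex.mul_re]
    have h2 := (Complex.abs_re_le_norm (intEmb φ t)).trans (hT t ht)
    have h3 : |(y t : ℝ) * (intEmb φ ω).re| ≤ 2 * r * (1 / 2) := by
      rw [abs_mul]
      have := hy t ht
      have h4 : 2 * r / sqrtDisc K ≤ 2 * r := div_le_self (by linarith) hd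
      gcongr
      linarith
    have h5 : (x t : ℝ) = (intEmb φ t).re - y t * (intEmb φ ω).re := by rw [h1]; ring
    rw [h5]
    have := abs_sub (intEmb φ t).re (y t * (intEmb φ ω).re)
    linarith
  have hfl : ∀ (m : ℤ) (B : ℝ), |(m : ℝ)| ≤ B → m ∈ Finset.Icc ⌊-B⌋ ⌊B⌋ := by
    intro m B h
    rw [abs_le] at h
    rw [Finset.mem_Icc]
    refine ⟨?_, Int.le_floor.2 h.2⟩
    have := (Int.floor_le (-B)).trans h.1
    exact_mod_cast this
  have hcard : T.card ≤ _ := Finset.card_le_card_of_injOn (fun t => (x t, y t))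
    (t := Finset.Icc ⌊-(2 * r)⌋ ⌊2 * r⌋ ×ˢ
      Finset.Icc ⌊-(2 * r / sqrtDisc K)⌋ ⌊2 * r / sqrtDisc K⌋)
    (fun t ht => Finset.mem_product.2 ⟨hfl _ _ (hx t ht), hfl _ _ (hy t ht)⟩)
    (fun t _ t' _ h => by
      simp only [Prod.mk.injEq] at h
      rw [hxy t, hxy t', h.1, h.2])
  rw [Finset.card_product] at hcard
  have h1 := card_Icc_floor_le (a := 2 * r) (by positivity)
  have h2 := card_Icc_floor_le (a := 2 * r / sqrtDisc K) (div_nonneg (by linarith) hd0.le)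
  calc (T.card : ℝ) ≤ _ := Nat.cast_le.2 hcard
    _ ≤ (2 * (2 * r) + 2) * (2 * (2 * r / sqrtDisc K) + 2) := by
      rw [Nat.cast_mul]
      exact mul_le_mul h1 h2 (Nat.cast_nonneg _) (by linarith)
    _ = 4 + 8 * r + 8 * (r / sqrtDisc K) + 16 * (r ^ 2 / sqrtDisc K) := by ring
    _ ≤ _ := by
      have h4 : r / sqrtDisc K ≤ r := div_le_self hr hd
      have h5 : 0 ≤ r ^ 2 / sqrtDisc K := div_nonneg (sq_nonneg _) hd0.le
      linarith

end Quadratic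

/-! ### The divisor bound, uniform in the field -/

/-- The local factor of the divisor bound at a prime of norm n and multiplicity e. If n ^ ε ≥ 2,
then e + 1 ≤ 2 ^ e needs no constant; for the remaining finitely many n, Bernoulli's inequality
gives the constant c. -/
theorem exists_add_one_le_rpow_pow {ε : ℝ} (hε : 0 < ε) : ∃ (c : ℝ) (Y : ℕ), 1 ≤ c ∧
    ∀ n : ℕ, 2 ≤ n → ∀ e : ℕ, (e + 1 : ℝ) ≤ (if n < Y then c else 1) * ((n : ℝ) ^ ε) ^ e := by
  have h2 : 1 < (2 : ℝ) ^ ε := Real.one_lt_rpow one_lt_two hε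
  set η := min 1 ((2 : ℝ) ^ ε - 1) with hη
  have hη0 : 0 < η := lt_min one_pos (by linarith)
  refine ⟨1 / η, ⌈(2 : ℝ) ^ (1 / ε)⌉₊, (one_le_div hη0).2 (min_le_left _ _), fun n hn e => ?_⟩
  have hn2 : (2 : ℝ) ≤ n := by exact_mod_cast hn
  split_ifs with h
  · have h3 : (2 : ℝ) ^ ε ≤ (n : ℝ) ^ ε := by gcongr
    have h4 : 1 + (e : ℝ) * η ≤ ((n : ℝ) ^ ε) ^ e := by
      refine (one_add_mul_le_pow (by linarith) e).trans ?_
      gcongr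
      linarith [min_le_right 1 ((2 : ℝ) ^ ε - 1)]
    rw [div_mul_eq_mul_div, one_mul, le_div_iff₀ hη0]
    have : η ≤ 1 := min_le_left _ _
    linarith
  · have h3 : (2 : ℝ) ≤ (n : ℝ) ^ ε := by
      have h5 : (2 : ℝ) ^ (1 / ε) ≤ n := (Nat.le_ceil _).trans (by exact_mod_cast not_lt.1 h)
      calc (2 : ℝ) = ((2 : ℝ) ^ (1 / ε)) ^ ε := by
            rw [← Real.rpow_mul zero_le_two, one_div_mul_cancel hε.ne', Real.rpow_one]
        _ ≤ _ := by gcongr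
    rw [one_mul]
    calc (e + 1 : ℝ) ≤ 2 ^ e := by exact_mod_cast (Nat.lt_two_pow_self (n := e))
      _ ≤ _ := by gcongr

section Ideals

variable {K : Type*} [Field K] [NumberField K] [Algebra.IsQuadraticExtension ℚ K]

theorem absNorm_span_natCast (n : ℕ) : Ideal.absNorm (Ideal.span {(n : 𝓞 K)}) = n ^ 2 := by
  have := norm_intCast (K := K) n
  rw [Int.cast_natCast] at this
  rw [Ideal.absNorm_span_singleton, this, Int.natAbs_pow, Int.natAbs_natCast]

/-- At most two prime ideals of a quadratic field have a given norm. -/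
theorem card_prime_ideals_le_two (F : Finset (Ideal (𝓞 K))) {n : ℕ} (hn : 2 ≤ n)
    (hF : ∀ P ∈ F, Prime P ∧ Ideal.absNorm P = n) : F.card ≤ 2 := by
  have h1 : ∏ P ∈ F, P ∣ Ideal.span {(n : 𝓞 K)} := by
    refine Finset.prod_primes_dvd _ (fun P hP => (hF P hP).1) fun P hP => ?_
    rw [Ideal.dvd_iff_le, Ideal.span_singleton_le_iff_mem, ← (hF P hP).2]
    exact Ideal.absNorm_mem P
  have h2 := Ideal.absNorm_dvd_absNorm_of_le (Ideal.le_of_dvd h1)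
  rw [absNorm_span_natCast, map_prod, Finset.prod_congr rfl (fun P hP => (hF P hP).2),
    Finset.prod_const] at h2
  exact (Nat.pow_le_pow_iff_right hn).1 (Nat.le_of_dvd (by positivity) h2)

open UniqueFactorizationMonoid in
-- Divisors of `I` correspond to submultisets of its prime factors, so their number is the product
-- of the e + 1. The constant c enters only for primes of norm below Y, and a quadratic field has at
-- most 2Y of those; hence c ^ (2Y) serves all fields.
theorem exists_ideal_divisor_bound {ε : ℝ} (hε : 0 < ε) : ∃ C : ℝ, 0 < C ∧
    ∀ (K : Type*) [Field K] [NumberField K] [Algebra.IsQuadraticExtension ℚ K]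
      (I : Ideal (𝓞 K)), I ≠ 0 →
      ((Finset.Iic (normalizedFactors I)).card : ℝ) ≤ C * (Ideal.absNorm I : ℝ) ^ ε := by
  classical
  obtain ⟨c, Y, hc, hcY⟩ := exists_add_one_le_rpow_pow hε
  refine ⟨c ^ (2 * Y), by positivity, fun K _ _ _ I hI => ?_⟩
  set s := normalizedFactors I with hs
  have hprime : ∀ P ∈ s.toFinset, Prime P := fun P hP =>
    prime_of_normalized_factor P (Multiset.mem_toFinset.1 hP)
  have htwo : ∀ P ∈ s.toFinset, 2 ≤ Ideal.absNorm P := by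
    intro P hP
    have h0 : Ideal.absNorm P ≠ 0 := by
      rw [Ne, Ideal.absNorm_eq_zero_iff]; exact (hprime P hP).ne_zero
    have h1 : Ideal.absNorm P ≠ 1 := by
      rw [Ne, Ideal.absNorm_eq_one_iff]
      exact fun h => (hprime P hP).not_isUnit (Ideal.isUnit_iff.2 h)
    omega
  have hnorm : (Ideal.absNorm I : ℝ) ^ ε =
      ∏ P ∈ s.toFinset, ((Ideal.absNorm P : ℝ) ^ ε) ^ s.count P := by
    have h1 : Ideal.absNorm I = ∏ P ∈ s.toFinset, Ideal.absNorm P ^ s.count P := by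
      conv_lhs => rw [← Ideal.prod_normalizedFactors_eq_self hI, ← hs,
        Finset.prod_multiset_count, map_prod]
      simp only [map_pow]
    rw [h1]
    push_cast
    rw [← Real.finsetProd_rpow _ _ (fun P _ => by positivity)]
    refine Finset.prod_congr rfl fun P _ => ?_
    rw [← Real.rpow_natCast, ← Real.rpow_natCast, ← Real.rpow_mul (by positivity),
      ← Real.rpow_mul (by positivity), mul_comm]
  have hsmall : (s.toFinset.filter (fun P => Ideal.absNorm P < Y)).card ≤ 2 * Y := by
    refine (Finset.card_le_mul_card_image (f := Ideal.absNorm) _ 2 fun n hn => ?_).trans ?_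
    · obtain ⟨P, hP, rfl⟩ := Finset.mem_image.1 hn
      refine card_prime_ideals_le_two _ (htwo P (Finset.mem_filter.1 hP).1) fun P' hP' => ?_
      obtain ⟨h1, h2⟩ := Finset.mem_filter.1 hP'
      exact ⟨hprime P' (Finset.mem_filter.1 h1).1, h2⟩
    · refine Nat.mul_le_mul_left _ ?_
      refine (Finset.card_le_card (t := Finset.range Y) fun n hn => ?_).trans
        (Finset.card_range Y).le
      obtain ⟨P, hP, rfl⟩ := Finset.mem_image.1 hn
      exact Finset.mem_range.2 (Finset.mem_filter.1 hP).2
  rw [Multiset.card_Iic, hnorm]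
  push_cast
  calc _ ≤ ∏ P ∈ s.toFinset, (if Ideal.absNorm P < Y then c else 1) *
        ((Ideal.absNorm P : ℝ) ^ ε) ^ s.count P :=
        Finset.prod_le_prod (fun P _ => by positivity) fun P hP => hcY _ (htwo P hP) _
    _ = c ^ (s.toFinset.filter (fun P => Ideal.absNorm P < Y)).card *
        ∏ P ∈ s.toFinset, ((Ideal.absNorm P : ℝ) ^ ε) ^ s.count P := by
        rw [Finset.prod_mul_distrib, Finset.prod_ite, Finset.prod_const, Finset.prod_const_one,
          mul_one]
    _ ≤ _ := mul_le_mul_of_nonneg_right (pow_le_pow_right₀ hc hsmall)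
        (Finset.prod_nonneg fun P _ => by positivity)

end Ideals

open UniqueFactorizationMonoid in
/-- The divisor bound in imaginary quadratic fields, uniformly in the field. -/
theorem exists_divisor_bound {ε : ℝ} (hε : 0 < ε) : ∃ C : ℝ, 0 < C ∧
    ∀ (K : Type*) [Field K] [NumberField K] [Algebra.IsQuadraticExtension ℚ K]
      [IsTotallyComplex K] (φ : K →+* ℂ) (x : 𝓞 K), x ≠ 0 →
      ∃ S : Finset (𝓞 K), (∀ h, h ∣ x → h ∈ S) ∧ (S.card : ℝ) ≤ C * ‖intEmb φ x‖ ^ ε := by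
  classical
  obtain ⟨C, hC, hCK⟩ := exists_ideal_divisor_bound (half_pos hε)
  refine ⟨144 * C, by positivity, fun K _ _ _ _ φ x hx => ?_⟩
  have hone : ∀ y : 𝓞 K, y ≠ 0 → 1 ≤ ‖intEmb φ y‖ := fun y hy => one_le_norm_intEmb φ hy
  refine ⟨(normBall K (‖intEmb φ x‖ ^ 2)).filter (fun h => h ∣ x), fun h hh => ?_, ?_⟩
  · refine Finset.mem_filter.2 ⟨(mem_normBall_iff φ).2 ?_, hh⟩
    obtain ⟨t, rfl⟩ := hh
    have h1 := hone t (right_ne_zero_of_mul hx)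
    rw [map_mul, norm_mul]
    gcongr
    exact le_mul_of_one_le_right (norm_nonneg _) h1
  set S := (normBall K (‖intEmb φ x‖ ^ 2)).filter (fun h => h ∣ x) with hS
  have hSx : ∀ h ∈ S, h ∣ x := fun h hh => (Finset.mem_filter.1 hh).2
  have hI : Ideal.span {x} ≠ 0 := by rwa [Ne, Ideal.zero_eq_bot, Ideal.span_singleton_eq_bot]
  have hnorm : (Ideal.absNorm (Ideal.span {x}) : ℝ) = ‖intEmb φ x‖ ^ 2 := by
    rw [Ideal.absNorm_span_singleton, Nat.cast_natAbs, Int.cast_abs, norm_eq_sq_norm K φ]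
    exact abs_of_nonneg (by positivity)
  -- Passing from ideals to generators costs the number of units. These have absolute value at most
  -- 1 and are 1-separated, so the packing bound gives at most 144.
  have h1 : S.card ≤ 144 * (S.image (fun h => Ideal.span {h})).card := by
    refine Finset.card_le_mul_card_image _ 144 fun J hJ => ?_
    obtain ⟨h, hh, rfl⟩ := Finset.mem_image.1 hJ
    have hh0 : h ≠ 0 := fun h0 => hx (zero_dvd_iff.1 (h0 ▸ hSx h hh))
    have hassoc : ∀ h' ∈ S.filter (fun h' => Ideal.span {h'} = Ideal.span {h}),
        ∃ u : (𝓞 K)ˣ, h' = h * u := by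
      intro h' hh'
      obtain ⟨u, hu⟩ := Ideal.span_singleton_eq_span_singleton.1 (Finset.mem_filter.1 hh').2
      exact ⟨u⁻¹, by rw [← hu, Units.mul_inv_cancel_right]⟩
    choose! u hu using hassoc
    have hunit : ∀ v : (𝓞 K)ˣ, ‖intEmb φ v‖ ≤ 1 := by
      intro v
      have h1 : ‖intEmb φ v‖ * ‖intEmb φ (v⁻¹ : (𝓞 K)ˣ)‖ = 1 := by
        rw [← norm_mul, ← map_mul, Units.mul_inv, map_one, norm_one]
      have h2 := hone _ (v⁻¹).ne_zero
      nlinarith [norm_nonneg (intEmb φ v)]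
    have := card_le_of_separated_one (S.filter (fun h' => Ideal.span {h'} = Ideal.span {h}))
      (fun h' => intEmb φ (u h')) one_pos zero_le_one (fun h' _ => hunit _) (by
        intro a ha b hb hab
        have := eq_of_norm_map_sub_lt_one (intEmb φ) hone hab
        rw [hu a ha, hu b hb, this])
    norm_num at this
    exact_mod_cast this
  have h2 : (S.image (fun h => Ideal.span {h})).card ≤
      (Finset.Iic (normalizedFactors (Ideal.span {x}))).card := by
    refine Finset.card_le_card_of_injOn normalizedFactors ?_ ?_
    · intro J hJ
      obtain ⟨h, hh, rfl⟩ := Finset.mem_image.1 hJ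
      have hh0 : h ≠ 0 := fun h0 => hx (zero_dvd_iff.1 (h0 ▸ hSx h hh))
      rw [Finset.coe_Iic, Set.mem_Iic,
        ← dvd_iff_normalizedFactors_le_normalizedFactors (by simpa using hh0) hI,
        Ideal.dvd_iff_le, Ideal.span_singleton_le_span_singleton]
      exact hSx h hh
    · intro J hJ J' hJ' hJJ
      obtain ⟨h, hh, rfl⟩ := Finset.mem_image.1 hJ
      obtain ⟨h', hh', rfl⟩ := Finset.mem_image.1 hJ'
      have hh0 : h ≠ 0 := fun h0 => hx (zero_dvd_iff.1 (h0 ▸ hSx h hh))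
      have hh0' : h' ≠ 0 := fun h0 => hx (zero_dvd_iff.1 (h0 ▸ hSx h' hh'))
      rw [← Ideal.prod_normalizedFactors_eq_self (I := Ideal.span {h}) (by simpa using hh0), hJJ,
        Ideal.prod_normalizedFactors_eq_self (by simpa using hh0')]
  have h3 := hCK K _ hI
  rw [hnorm] at h3
  have e : (‖intEmb φ x‖ ^ 2) ^ (ε / 2) = ‖intEmb φ x‖ ^ ε := by
    rw [← Real.rpow_natCast, ← Real.rpow_mul (norm_nonneg _)]
    congr 1
    push_cast
    ring
  rw [e] at h3
  calc (S.card : ℝ) ≤ 144 * (Finset.Iic (normalizedFactors (Ideal.span {x}))).card := by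
        exact_mod_cast h1.trans (Nat.mul_le_mul_left _ h2)
    _ ≤ 144 * (C * ‖intEmb φ x‖ ^ ε) := by gcongr
    _ = _ := by ring

/-! ### The additive character and Parseval's identity -/

section Character

variable {K : Type*} [Field K] [NumberField K]

theorem eTilde_eq (z : ℂ) :
    eTilde (discr K) z =
      Complex.exp (2 * Real.pi * Complex.I * ((2 * z.im / sqrtDisc K : ℝ) : ℂ)) := by
  have h : z / (Complex.I * Real.sqrt (-(discr K : ℝ))) -
      starRingEnd ℂ z / (Complex.I * Real.sqrt (-(discr K : ℝ))) =
      ((2 * z.im / sqrtDisc K : ℝ) : ℂ) := by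
    rw [← sub_div, Complex.sub_conj, mul_comm Complex.I, mul_div_mul_right _ _ Complex.I_ne_zero]
    push_cast
    rfl
  rw [eTilde, h]

theorem eTilde_add (z w : ℂ) :
    eTilde (discr K) (z + w) = eTilde (discr K) z * eTilde (discr K) w := by
  rw [eTilde_eq, eTilde_eq, eTilde_eq, ← Complex.exp_add, Complex.add_im]
  congr 1
  push_cast
  ring

theorem norm_eTilde (z : ℂ) : ‖eTilde (discr K) z‖ = 1 := by
  rw [eTilde_eq, show (2 * Real.pi * Complex.I * ((2 * z.im / sqrtDisc K : ℝ) : ℂ)) =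
    ((2 * Real.pi * (2 * z.im / sqrtDisc K) : ℝ) : ℂ) * Complex.I by push_cast; ring,
    Complex.norm_exp_ofReal_mul_I]

theorem eTilde_sub (z w : ℂ) :
    eTilde (discr K) (z - w) = eTilde (discr K) z * starRingEnd ℂ (eTilde (discr K) w) := by
  have h1 : eTilde (discr K) w * starRingEnd ℂ (eTilde (discr K) w) = 1 := by
    rw [Complex.mul_conj, Complex.normSq_eq_norm_sq, norm_eTilde]; simp
  have h2 := eTilde_add (K := K) (z - w) w
  rw [sub_add_cancel] at h2
  rw [h2, mul_assoc, h1, mul_one]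

/-- The hypothesis keeps 2 Im z / d at most 1 / 6 in absolute value, so the angle is at most π / 3.
This is the source of the 12 in all disc radii below. -/
theorem half_le_re_eTilde {z : ℂ} (hz : 12 * ‖z‖ ≤ sqrtDisc K) (hd : 0 < sqrtDisc K) :
    1 / 2 ≤ (eTilde (discr K) z).re := by
  rw [eTilde_eq, show (2 * Real.pi * Complex.I * ((2 * z.im / sqrtDisc K : ℝ) : ℂ)) =
    ((2 * Real.pi * (2 * z.im / sqrtDisc K) : ℝ) : ℂ) * Complex.I by push_cast; ring,
    Complex.exp_ofReal_mul_I_re, ← Real.cos_pi_div_three,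
    ← Real.cos_abs (2 * Real.pi * _)]
  apply Real.cos_le_cos_of_nonneg_of_le_pi (abs_nonneg _) (by linarith [Real.pi_pos])
  rw [abs_mul, abs_of_pos Real.two_pi_pos, abs_div, abs_of_pos hd, abs_mul, abs_two]
  have h1 : 2 * |z.im| / sqrtDisc K ≤ 1 / 6 := by
    rw [div_le_iff₀ hd]
    linarith [Complex.abs_im_le_norm z]
  nlinarith [Real.pi_pos]

theorem two_mul_im_div_eq_of_eTilde_eq_one {z : ℂ} (hz : eTilde (discr K) z = 1) :
    ∃ n : ℤ, 2 * z.im / sqrtDisc K = n := by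
  rw [eTilde_eq, Complex.exp_eq_one_iff] at hz
  obtain ⟨n, hn⟩ := hz
  refine ⟨n, ?_⟩
  have h2 : (2 * Real.pi * Complex.I : ℂ) ≠ 0 := Complex.two_pi_I_ne_zero
  have h3 : ((2 * z.im / sqrtDisc K : ℝ) : ℂ) = n :=
    mul_left_cancel₀ h2 (by rw [hn]; ring)
  exact_mod_cast h3

end Character

section Cardinality

variable {K : Type*} [Field K] [NumberField K] [Algebra.IsQuadraticExtension ℚ K]

theorem card_quotient_span_natCast (P : ℕ) [Fintype (𝓞 K ⧸ Ideal.span {(P : 𝓞 K)})] :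
    Fintype.card (𝓞 K ⧸ Ideal.span {(P : 𝓞 K)}) = P ^ 2 := by
  rw [← absNorm_span_natCast (K := K) P, Ideal.absNorm_apply, Submodule.cardQuot_apply,
    Nat.card_eq_fintype_card]

end Cardinality

section Parseval

variable {K : Type*} [Field K] [NumberField K]
  [Algebra.IsQuadraticExtension ℚ K] [IsTotallyComplex K] (φ : K →+* ℂ)

/-- For t = x + yω the phase 2 Im t / d equals ±y, an integer. -/
theorem eTilde_intEmb (t : 𝓞 K) : eTilde (discr K) (intEmb φ t) = 1 := by
  obtain ⟨ω, hω, -, him⟩ := exists_reduced_generator φ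
  have hd := one_le_sqrtDisc K
  obtain ⟨x, y, rfl⟩ := hω t
  rw [eTilde_eq, Complex.exp_eq_one_iff]
  have h1 : (intEmb φ (x + y * ω)).im = y * (intEmb φ ω).im := by
    simp [Complex.add_im, Complex.mul_im]
  rw [h1, ← him]
  have h0 : (intEmb φ ω).im ≠ 0 := by
    intro h; rw [h, abs_zero] at him; linarith
  rcases abs_choice (intEmb φ ω).im with h | h
  · refine ⟨y, ?_⟩
    rw [h, show 2 * ((y : ℝ) * (intEmb φ ω).im) / (2 * (intEmb φ ω).im) = y by field_simp]
    push_cast; ring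
  · refine ⟨-y, ?_⟩
    rw [h, show 2 * ((y : ℝ) * (intEmb φ ω).im) / (2 * -(intEmb φ ω).im) = -y by field_simp]
    push_cast; ring

theorem eTilde_add_intEmb (z : ℂ) (t : 𝓞 K) :
    eTilde (discr K) (z + intEmb φ t) = eTilde (discr K) z := by
  rw [eTilde_add, eTilde_intEmb, mul_one]

/-- The ring of integers is self-dual with respect to the additive character. -/
theorem natCast_dvd_of_eTilde_eq_one {P : ℕ} (hP : P ≠ 0) {x : 𝓞 K}
    (h : ∀ y : 𝓞 K, eTilde (discr K) (intEmb φ (x * y) / P) = 1) : (P : 𝓞 K) ∣ x := by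
  obtain ⟨ω, hω, -, him⟩ := exists_reduced_generator φ
  have hd := one_le_sqrtDisc K
  have hP' : (P : ℝ) ≠ 0 := by exact_mod_cast hP
  have h0 : (intEmb φ ω).im ≠ 0 := by
    intro h; rw [h, abs_zero] at him; linarith
  have key : ∀ a b : ℤ, eTilde (discr K) (intEmb φ (a + b * ω) / P) = 1 → (P : ℤ) ∣ b := by
    intro a b hab
    obtain ⟨n, hn⟩ := two_mul_im_div_eq_of_eTilde_eq_one hab
    have h1 : (intEmb φ (a + b * ω) / P).im = b * (intEmb φ ω).im / P := by
      rw [Complex.div_natCast_im]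
      simp [Complex.add_im, Complex.mul_im]
    rw [h1, ← him] at hn
    rcases abs_choice (intEmb φ ω).im with h | h
    · rw [h] at hn
      refine ⟨n, ?_⟩
      field_simp at hn
      exact_mod_cast hn
    · rw [h] at hn
      refine ⟨-n, ?_⟩
      field_simp at hn
      have : (b : ℝ) = P * -n := by linarith
      exact_mod_cast this
  obtain ⟨a, b, rfl⟩ := hω x
  obtain ⟨u, v, huv⟩ := hω (ω * ω)
  obtain ⟨b', rfl⟩ := key a b (by simpa using h 1)
  -- Testing against 1 shows that P divides the ω-coordinate of x. Testing against ω, with ω ^ 2 = u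
  -- + vω, handles the other coordinate.
  obtain ⟨c, hc⟩ := key (P * b' * u) (a + P * b' * v) (by
    have := h ω
    rwa [show ((a : 𝓞 K) + ((P * b' : ℤ) : 𝓞 K) * ω) * ω =
      ((P * b' * u : ℤ) : 𝓞 K) + ((a + P * b' * v : ℤ) : 𝓞 K) * ω by
        push_cast; linear_combination (P * b' : 𝓞 K) * huv] at this)
  have ha : a = P * (c - b' * v) := by linear_combination hc
  refine ⟨(c - b' * v : ℤ) + b' * ω, ?_⟩
  rw [ha]
  push_cast
  ring

/-- A generic exponential sum at points of `P⁻¹ 𝓞 K`. -/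
noncomputable def ratSum (P : ℕ) (S : Finset (𝓞 K)) (b : 𝓞 K → ℂ) (x : 𝓞 K) : ℂ :=
  ∑ n ∈ S, b n * eTilde (discr K) (intEmb φ (n * x) / P)

theorem eTilde_div_congr {P : ℕ} (hP : P ≠ 0) {x y : 𝓞 K} (h : (P : 𝓞 K) ∣ x - y) (n : 𝓞 K) :
    eTilde (discr K) (intEmb φ (n * x) / P) = eTilde (discr K) (intEmb φ (n * y) / P) := by
  obtain ⟨t, ht⟩ := h
  have hP' : (P : ℂ) ≠ 0 := by exact_mod_cast hP
  rw [sub_eq_iff_eq_add.1 ht, ← eTilde_add_intEmb φ (intEmb φ (n * y) / P) (n * t)]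
  congr 1
  simp only [map_mul, map_add, map_natCast]
  field_simp
  ring

/-- Translating the class by some y with nontrivial character value multiplies the sum by that
value. Such a y exists by the self-duality of 𝓞 K. -/
theorem sum_eTilde_eq_zero {P : ℕ} (hP : P ≠ 0) [Fintype (𝓞 K ⧸ Ideal.span {(P : 𝓞 K)})]
    {n : 𝓞 K} (hn : ¬ (P : 𝓞 K) ∣ n) :
    ∑ g : 𝓞 K ⧸ Ideal.span {(P : 𝓞 K)},
      eTilde (discr K) (intEmb φ (n * Quotient.out g) / P) = 0 := by
  obtain ⟨y, hy⟩ : ∃ y : 𝓞 K, eTilde (discr K) (intEmb φ (n * y) / P) ≠ 1 := by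
    by_contra h
    push Not at h
    exact hn (natCast_dvd_of_eTilde_eq_one φ hP h)
  set s := ∑ g : 𝓞 K ⧸ Ideal.span {(P : 𝓞 K)},
    eTilde (discr K) (intEmb φ (n * Quotient.out g) / P) with hs
  have h1 : s = s * eTilde (discr K) (intEmb φ (n * y) / P) := by
    conv_lhs => rw [hs, ← Equiv.sum_comp (Equiv.addRight (Ideal.Quotient.mk _ y))]
    rw [hs, Finset.sum_mul]
    refine Finset.sum_congr rfl fun g _ => ?_
    rw [← eTilde_add, ← add_div, ← map_add, ← mul_add]
    apply eTilde_div_congr φ hP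
    rw [← Ideal.mem_span_singleton, ← Ideal.Quotient.eq, Ideal.Quotient.mk_out]
    simp
  have h2 : s * (eTilde (discr K) (intEmb φ (n * y) / P) - 1) = 0 := by
    linear_combination -h1
  exact (mul_eq_zero.1 h2).resolve_right (sub_ne_zero.2 hy)

theorem sum_norm_ratSum_sq {P : ℕ} (hP : P ≠ 0) [Fintype (𝓞 K ⧸ Ideal.span {(P : 𝓞 K)})]
    (S : Finset (𝓞 K)) (hS : ∀ n ∈ S, ∀ n' ∈ S, (P : 𝓞 K) ∣ n - n' → n = n') (b : 𝓞 K → ℂ) :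
    ∑ g : 𝓞 K ⧸ Ideal.span {(P : 𝓞 K)}, ‖ratSum φ P S b (Quotient.out g)‖ ^ 2 =
      P ^ 2 * ∑ n ∈ S, ‖b n‖ ^ 2 := by
  have h : ∑ g : 𝓞 K ⧸ Ideal.span {(P : 𝓞 K)},
      ratSum φ P S b (Quotient.out g) * starRingEnd ℂ (ratSum φ P S b (Quotient.out g)) =
      P ^ 2 * ∑ n ∈ S, b n * starRingEnd ℂ (b n) := by
    have h1 : ∀ g : 𝓞 K ⧸ Ideal.span {(P : 𝓞 K)},
        ratSum φ P S b (Quotient.out g) * starRingEnd ℂ (ratSum φ P S b (Quotient.out g)) =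
        ∑ n ∈ S, ∑ n' ∈ S, b n * starRingEnd ℂ (b n') *
          eTilde (discr K) (intEmb φ ((n - n') * Quotient.out g) / P) := by
      intro g
      rw [ratSum, map_sum, Finset.sum_mul_sum]
      refine Finset.sum_congr rfl fun n _ => Finset.sum_congr rfl fun n' _ => ?_
      rw [sub_mul, map_sub, sub_div, eTilde_sub, map_mul (starRingEnd ℂ)]
      ring
    simp only [h1]
    rw [Finset.sum_comm, Finset.mul_sum]
    refine Finset.sum_congr rfl fun n hn => ?_
    rw [Finset.sum_comm, Finset.sum_eq_single_of_mem n hn]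
    · rw [← Finset.mul_sum]
      simp only [sub_self, zero_mul, map_zero, zero_div]
      have h2 : eTilde (discr K) 0 = 1 := by simpa using eTilde_intEmb φ 0
      rw [h2, Finset.sum_const, Finset.card_univ, card_quotient_span_natCast]
      simp
      ring
    · intro n' hn' hne
      rw [← Finset.mul_sum, sum_eTilde_eq_zero φ hP, mul_zero]
      exact fun hdvd => hne (hS n hn n' hn' hdvd).symm
  simp only [Complex.mul_conj, Complex.normSq_eq_norm_sq] at h
  exact_mod_cast h

end Parseval

/-! ### The large sieve -/

section Sieve

variable {K : Type*} [Field K] [NumberField K]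
  [Algebra.IsQuadraticExtension ℚ K] [IsTotallyComplex K] (φ : K →+* ℂ)

/-- If w n is the average over T of the character at n t / P, then |w n| ≥ 1 / 2 on the ball,
because t / P is small. Hence the sum with coefficients a at r / m is exactly the average over T of
the sum with coefficients a / w at r / m + t / P. Cauchy–Schwarz and Parseval finish the proof,
since each class modulo P is hit by at most M pairs (i, t). -/
theorem sum_norm_sq_le_of_average {ι : Type*} (I : Finset ι) (m r : ι → 𝓞 K) {P : ℕ} (hP : P ≠ 0)
    (hm : ∀ i ∈ I, m i ≠ 0 ∧ m i ∣ (P : 𝓞 K)) {N M : ℝ} (hN : 0 < N) (hPN : 4 * N < (P : ℝ) ^ 2)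
    (T : Finset (𝓞 K)) (hT0 : T.Nonempty)
    (hT : ∀ t ∈ T, ‖intEmb φ t‖ ≤ P * (sqrtDisc K / (12 * √N)))
    (hM : ∀ (g : ℂ) (J : Finset (ι × 𝓞 K)), (∀ v ∈ J, v.1 ∈ I ∧ m v.1 ∣ r v.1 - v.2 ∧
      ‖intEmb φ v.2 - intEmb φ (m v.1) * g‖ ≤ ‖intEmb φ (m v.1)‖ * (sqrtDisc K / (12 * √N))) →
      (J.card : ℝ) ≤ M) (a : 𝓞 K → ℂ) :
    ∑ i ∈ I, ‖∑ n ∈ normBall K N, a n *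
      eTilde (discr K) (intEmb φ n * intEmb φ (r i) / intEmb φ (m i))‖ ^ 2 ≤
      4 * (P ^ 2 / T.card) * M * ∑ n ∈ normBall K N, ‖a n‖ ^ 2 := by
  classical
  have hd := one_le_sqrtDisc K
  have hd0 : 0 < sqrtDisc K := by linarith
  have hone : ∀ y : 𝓞 K, y ≠ 0 → 1 ≤ ‖intEmb φ y‖ := fun y hy => one_le_norm_intEmb φ hy
  have hP0 : (0 : ℝ) < P := by exact_mod_cast Nat.pos_of_ne_zero hP
  have hPC : (P : ℂ) ≠ 0 := by exact_mod_cast hP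
  have hTc : (0 : ℝ) < T.card := by exact_mod_cast hT0.card_pos
  have hPR : (P : 𝓞 K) ≠ 0 := by exact_mod_cast hP
  have hfin : Finite (𝓞 K ⧸ Ideal.span {(P : 𝓞 K)}) :=
    Ideal.finiteQuotientOfFreeOfNeBot _ (by rwa [Ne, Ideal.span_singleton_eq_bot])
  have := Fintype.ofFinite (𝓞 K ⧸ Ideal.span {(P : 𝓞 K)})
  have hball : ∀ n ∈ normBall K N, ‖intEmb φ n‖ ≤ √N := fun n hn =>
    Real.le_sqrt_of_sq_le ((mem_normBall_iff φ).1 hn)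
  choose! c hc using fun i hi => (hm i hi).2
  -- The average of the character over `T` is bounded below.
  set w : 𝓞 K → ℂ := fun n => (∑ t ∈ T, eTilde (discr K) (intEmb φ (n * t) / P)) / T.card with hw
  have hwn : ∀ n ∈ normBall K N, 1 / 2 ≤ ‖w n‖ := by
    intro n hn
    refine le_trans ?_ (Complex.re_le_norm _)
    simp only [hw]
    rw [Complex.div_natCast_re, Complex.re_sum, le_div_iff₀ hTc]
    calc (1 / 2 : ℝ) * T.card = ∑ t ∈ T, (1 / 2 : ℝ) := by
          rw [Finset.sum_const, nsmul_eq_mul, mul_comm]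
      _ ≤ _ := Finset.sum_le_sum fun t ht => half_le_re_eTilde ?_ hd0
    rw [map_mul, norm_div, norm_mul, Complex.norm_natCast]
    have h1 : ‖intEmb φ n‖ * ‖intEmb φ t‖ ≤ √N * (P * (sqrtDisc K / (12 * √N))) :=
      mul_le_mul (hball n hn) (hT t ht) (norm_nonneg _) (Real.sqrt_nonneg _)
    have hsN : √N ≠ 0 := (Real.sqrt_pos.2 hN).ne'
    have h2 : √N * (P * (sqrtDisc K / (12 * √N))) = P * sqrtDisc K / 12 := by field_simp
    rw [h2] at h1
    rw [mul_div_assoc', div_le_iff₀ hP0]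
    linarith
  set b : 𝓞 K → ℂ := fun n => a n / w n with hb
  have hbn : ∀ n ∈ normBall K N, ‖b n‖ ^ 2 ≤ 4 * ‖a n‖ ^ 2 := by
    intro n hn
    have h1 := hwn n hn
    have h2 : ‖b n‖ ≤ 2 * ‖a n‖ := by
      simp only [hb]
      rw [norm_div, div_le_iff₀ (by linarith)]
      nlinarith [norm_nonneg (a n)]
    nlinarith [norm_nonneg (b n)]
  set F : 𝓞 K → ℝ := fun x => ‖ratSum φ P (normBall K N) b x‖ ^ 2 with hF
  have hFcongr : ∀ x y : 𝓞 K, (P : 𝓞 K) ∣ x - y → F x = F y := by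
    intro x y hxy
    simp only [hF, ratSum, eTilde_div_congr φ hP hxy]
  -- Two elements of the ball differ by at most 2 √N < P, while nonzero multiples of P have absolute
  -- value at least P.
  have hS : ∀ n ∈ normBall K N, ∀ n' ∈ normBall K N, (P : 𝓞 K) ∣ n - n' → n = n' := by
    rintro n hn n' hn' ⟨t, ht⟩
    by_contra hne
    have ht0 : t ≠ 0 := by
      rintro rfl; rw [mul_zero] at ht; exact hne (sub_eq_zero.1 ht)
    have h1 : (P : ℝ) ≤ ‖intEmb φ (n - n')‖ := by
      rw [ht, map_mul, norm_mul, map_natCast, Complex.norm_natCast]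
      exact le_mul_of_one_le_right hP0.le (hone t ht0)
    rw [map_sub] at h1
    have h2 := (norm_sub_le _ _).trans (add_le_add (hball n hn) (hball n' hn'))
    have h3 := Real.sq_sqrt hN.le
    nlinarith [Real.sqrt_nonneg N]
  have hpars := sum_norm_ratSum_sq φ hP (normBall K N) hS b
  -- Replacing a point by an average over nearby points.
  have hpoint : ∀ i ∈ I, ‖∑ n ∈ normBall K N, a n *
      eTilde (discr K) (intEmb φ n * intEmb φ (r i) / intEmb φ (m i))‖ ^ 2 ≤
      (∑ t ∈ T, F (r i * c i + t)) / T.card := by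
    intro i hi
    have hmi : intEmb φ (m i) ≠ 0 := by
      have := hone _ (hm i hi).1
      intro h0; rw [h0, norm_zero] at this; linarith
    have hPi : (P : ℂ) = intEmb φ (m i) * intEmb φ (c i) := by
      rw [← map_mul, ← hc i hi, map_natCast]
    have e : ∑ n ∈ normBall K N, a n *
        eTilde (discr K) (intEmb φ n * intEmb φ (r i) / intEmb φ (m i)) =
        (∑ t ∈ T, ratSum φ P (normBall K N) b (r i * c i + t)) / T.card := by
      simp only [ratSum]
      rw [Finset.sum_comm, Finset.sum_div]
      refine Finset.sum_congr rfl fun n hn => ?_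
      have hw0 : w n ≠ 0 := by
        have := hwn n hn
        intro h0; rw [h0, norm_zero] at this; linarith
      have e1 : intEmb φ n * intEmb φ (r i) / intEmb φ (m i) = intEmb φ (n * (r i * c i)) / P := by
        rw [div_eq_div_iff hmi hPC, hPi]; simp only [map_mul]; ring
      have e2 : ∀ t, eTilde (discr K) (intEmb φ (n * (r i * c i + t)) / P) =
          eTilde (discr K) (intEmb φ (n * (r i * c i)) / P) *
          eTilde (discr K) (intEmb φ (n * t) / P) := by
        intro t
        rw [← eTilde_add, mul_add, map_add, add_div]
      simp only [e2]
      rw [e1, ← Finset.mul_sum, ← Finset.mul_sum, mul_div_assoc, mul_div_assoc]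
      change _ = a n / w n * (_ * w n)
      field_simp
    rw [e, norm_div, Complex.norm_natCast, div_pow, div_le_div_iff₀ (by positivity) hTc]
    have h1 : ‖∑ t ∈ T, ratSum φ P (normBall K N) b (r i * c i + t)‖ ^ 2 ≤
        T.card * ∑ t ∈ T, F (r i * c i + t) := by
      calc _ ≤ (∑ t ∈ T, ‖ratSum φ P (normBall K N) b (r i * c i + t)‖) ^ 2 := by
            gcongr; exact norm_sum_le _ _
        _ ≤ _ := sq_sum_le_card_mul_sum_sq
    nlinarith
  -- Counting the points near a given one.
  have hcount : ∀ g : 𝓞 K ⧸ Ideal.span {(P : 𝓞 K)}, (((I ×ˢ T).filter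
      (fun v => Ideal.Quotient.mk (Ideal.span {(P : 𝓞 K)}) (r v.1 * c v.1 + v.2) = g)).card : ℝ)
      ≤ M := by
    intro g
    set γ : 𝓞 K := Quotient.out g with hγ
    set J := (I ×ˢ T).filter
      (fun v => Ideal.Quotient.mk (Ideal.span {(P : 𝓞 K)}) (r v.1 * c v.1 + v.2) = g) with hJ
    have hJ' : ∀ v ∈ J, v.1 ∈ I ∧ v.2 ∈ T ∧ ∃ l, r v.1 * c v.1 + v.2 - γ = P * l := by
      intro v hv
      obtain ⟨h1, h2⟩ := Finset.mem_filter.1 hv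
      refine ⟨(Finset.mem_product.1 h1).1, (Finset.mem_product.1 h1).2, ?_⟩
      have : (P : 𝓞 K) ∣ r v.1 * c v.1 + v.2 - γ := by
        rw [← Ideal.mem_span_singleton, ← Ideal.Quotient.eq, h2, hγ, Ideal.Quotient.mk_out]
      exact this
    choose! hJ1 hJ2 l hl using hJ'
    have hs : ∀ v ∈ J, (r v.1 - m v.1 * l v) * c v.1 = γ - v.2 := by
      intro v hv
      linear_combination hl v hv + l v * hc v.1 (hJ1 v hv)
    -- A pair (i, t) over the class of γ is encoded by i and the numerator s with s / m = (γ - t) /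
    -- P. This fraction is congruent to r / m and lies near γ / P, so `hM` counts it.
    have hinj : Set.InjOn (fun v => (v.1, r v.1 - m v.1 * l v)) (J : Set (ι × 𝓞 K)) := by
      intro v hv v' hv' h
      simp only [Prod.mk.injEq] at h
      have h1 := hs v hv
      have h2 := hs v' hv'
      rw [h.2, h.1] at h1
      refine Prod.ext h.1 ?_
      linear_combination h1 - h2
    rw [← Finset.card_image_of_injOn hinj]
    refine hM (intEmb φ γ / P) _ fun u hu => ?_
    obtain ⟨v, hv, rfl⟩ := Finset.mem_image.1 hu
    refine ⟨hJ1 v hv, ⟨l v, by ring⟩, ?_⟩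
    have hPi : (P : ℂ) = intEmb φ (m v.1) * intEmb φ (c v.1) := by
      rw [← map_mul, ← hc _ (hJ1 v hv), map_natCast]
    have h1 := congrArg (intEmb φ) (hs v hv)
    rw [map_mul, map_sub (intEmb φ) γ] at h1
    have e : intEmb φ (r v.1 - m v.1 * l v) - intEmb φ (m v.1) * (intEmb φ γ / P) =
        -(intEmb φ (m v.1) * (intEmb φ v.2 / P)) := by
      field_simp
      rw [hPi]
      linear_combination intEmb φ (m v.1) * h1
    rw [e, norm_neg, norm_mul, norm_div, Complex.norm_natCast]
    refine mul_le_mul_of_nonneg_left ?_ (norm_nonneg _)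
    rw [div_le_iff₀ hP0, mul_comm]
    exact hT _ (hJ2 v hv)
  have hM0 : 0 ≤ M := by simpa using hM 0 ∅ (by simp)
  have hsum : ∑ v ∈ I ×ˢ T, F (r v.1 * c v.1 + v.2) ≤
      M * (P ^ 2 * ∑ n ∈ normBall K N, ‖b n‖ ^ 2) := by
    rw [← hpars, ← Finset.sum_fiberwise (I ×ˢ T)
      (fun v => Ideal.Quotient.mk (Ideal.span {(P : 𝓞 K)}) (r v.1 * c v.1 + v.2)), Finset.mul_sum]
    refine Finset.sum_le_sum fun g _ => ?_
    have h1 : ∀ v ∈ (I ×ˢ T).filter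
        (fun v => Ideal.Quotient.mk (Ideal.span {(P : 𝓞 K)}) (r v.1 * c v.1 + v.2) = g),
        F (r v.1 * c v.1 + v.2) = F (Quotient.out g) := by
      intro v hv
      apply hFcongr
      rw [← Ideal.mem_span_singleton, ← Ideal.Quotient.eq, (Finset.mem_filter.1 hv).2,
        Ideal.Quotient.mk_out]
    rw [Finset.sum_congr rfl h1, Finset.sum_const, nsmul_eq_mul]
    exact mul_le_mul_of_nonneg_right (hcount g) (by positivity)
  calc _ ≤ ∑ i ∈ I, (∑ t ∈ T, F (r i * c i + t)) / T.card := Finset.sum_le_sum hpoint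
    _ = (∑ v ∈ I ×ˢ T, F (r v.1 * c v.1 + v.2)) / T.card := by
        rw [← Finset.sum_div, Finset.sum_product]
    _ ≤ M * (P ^ 2 * ∑ n ∈ normBall K N, 4 * ‖a n‖ ^ 2) / T.card := by
        refine div_le_div_of_nonneg_right (hsum.trans ?_) hTc.le
        refine mul_le_mul_of_nonneg_left (mul_le_mul_of_nonneg_left ?_ (by positivity)) hM0
        exact Finset.sum_le_sum hbn
    _ = _ := by rw [← Finset.mul_sum]; ring

/-- The large sieve: exponential sums at a set of fractions are bounded in terms of the number of
fractions in small discs. -/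
theorem large_sieve {ι : Type*} (I : Finset ι) (m r : ι → 𝓞 K) (hm : ∀ i ∈ I, m i ≠ 0)
    {N M : ℝ} (hN : 1 ≤ N)
    (hM : ∀ (g : ℂ) (J : Finset (ι × 𝓞 K)), (∀ v ∈ J, v.1 ∈ I ∧ m v.1 ∣ r v.1 - v.2 ∧
      ‖intEmb φ v.2 - intEmb φ (m v.1) * g‖ ≤ ‖intEmb φ (m v.1)‖ * (sqrtDisc K / (12 * √N))) →
      (J.card : ℝ) ≤ M) (a : 𝓞 K → ℂ) :
    ∑ i ∈ I, ‖∑ n ∈ normBall K N, a n *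
      eTilde (discr K) (intEmb φ n * intEmb φ (r i) / intEmb φ (m i))‖ ^ 2 ≤
      9216 * (N / sqrtDisc K) * M * ∑ n ∈ normBall K N, ‖a n‖ ^ 2 := by
  classical
  obtain ⟨ω, -, hre, him⟩ := exists_reduced_generator φ
  have hd := one_le_sqrtDisc K
  have hd0 : 0 < sqrtDisc K := by linarith
  have hN0 : 0 < N := by linarith
  have hsN : 1 ≤ √N := Real.one_le_sqrt.2 hN
  have hsN0 : 0 < √N := by linarith
  have hsq := Real.sq_sqrt hN0.le
  set P₀ : ℕ := ∏ i ∈ I, Ideal.absNorm (Ideal.span {m i}) with hP₀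
  have hP₀0 : P₀ ≠ 0 := by
    rw [hP₀, Finset.prod_ne_zero_iff]
    intro i hi
    rw [Ne, Ideal.absNorm_eq_zero_iff, Ideal.span_singleton_eq_bot]
    exact hm i hi
  have hdvd : ∀ i ∈ I, m i ∣ (P₀ : 𝓞 K) := by
    intro i hi
    have h1 : m i ∣ ((Ideal.absNorm (Ideal.span {m i}) : ℕ) : 𝓞 K) :=
      Ideal.mem_span_singleton.1 (Ideal.absNorm_mem _)
    exact h1.trans (Nat.cast_dvd_cast (Finset.dvd_prod_of_mem _ hi))
  -- P₀ is a common multiple of the moduli; the second factor makes y ≥ 1 below and gives 4 N < P ^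
  -- 2.
  set P : ℕ := P₀ * ⌈24 * √N⌉₊ with hPdef
  have hPge : 24 * √N ≤ P := by
    have h1 : (1 : ℝ) ≤ P₀ := by exact_mod_cast Nat.one_le_iff_ne_zero.2 hP₀0
    have h2 := Nat.le_ceil (24 * √N)
    rw [hPdef]
    push_cast
    nlinarith
  have hP0 : (0 : ℝ) < P := by linarith
  have hPne : P ≠ 0 := by rintro h; rw [h] at hP0; simp at hP0
  set y : ℝ := P / (24 * √N) with hy
  have hy1 : 1 ≤ y := by rw [hy, one_le_div (by positivity)]; exact hPge
  have hyd : 1 ≤ y * sqrtDisc K := by nlinarith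
  have hflo : ∀ x : ℝ, 1 ≤ x → x / 2 ≤ (⌊x⌋₊ : ℝ) := by
    intro x hx
    have h1 := Nat.lt_floor_add_one x
    have h2 : (1 : ℝ) ≤ ⌊x⌋₊ := by exact_mod_cast Nat.one_le_floor_iff x |>.2 hx
    linarith
  set f : ℕ × ℕ → 𝓞 K := fun v => v.1 + v.2 * ω with hf
  have h0 : (intEmb φ ω).im ≠ 0 := by
    intro h; rw [h, abs_zero] at him; linarith
  have hfinj : Function.Injective f := by
    intro u v huv
    have h1 := congrArg (intEmb φ) huv
    simp only [hf, map_add, map_mul, map_natCast] at h1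
    have h2 : (u.2 : ℝ) = v.2 := by
      have := congrArg Complex.im h1
      simp only [Complex.add_im, Complex.mul_im, Complex.natCast_im, Complex.natCast_re,
        zero_mul, add_zero, zero_add] at this
      exact mul_right_cancel₀ h0 this
    have h3 : u.2 = v.2 := by exact_mod_cast h2
    rw [h3] at h1
    exact Prod.ext (by exact_mod_cast add_right_cancel h1) h3
  -- A box of x + yω with sides in proportion d : 1. As ‖ω‖ ≤ d it lies in the disc of radius 2yd =
  -- P d / (12 √N), and it has at least y ^ 2 d / 4 points, a positive proportion of those in the
  -- disc, uniformly in the field.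
  set T : Finset (𝓞 K) :=
    (Finset.range ⌊y * sqrtDisc K⌋₊ ×ˢ Finset.range ⌊y⌋₊).image f with hT
  have hTcard : T.card = ⌊y * sqrtDisc K⌋₊ * ⌊y⌋₊ := by
    rw [hT, Finset.card_image_of_injective _ hfinj, Finset.card_product, Finset.card_range,
      Finset.card_range]
  have hTge : y ^ 2 * sqrtDisc K / 4 ≤ T.card := by
    rw [hTcard]
    push_cast
    calc y ^ 2 * sqrtDisc K / 4 = (y * sqrtDisc K / 2) * (y / 2) := by ring
      _ ≤ _ := mul_le_mul (hflo _ hyd) (hflo _ hy1) (by positivity) (by positivity)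
  have hTpos : (0 : ℝ) < T.card := lt_of_lt_of_le (by positivity) hTge
  have hω : ‖intEmb φ ω‖ ≤ sqrtDisc K := by
    have := Complex.norm_le_abs_re_add_abs_im (intEmb φ ω)
    linarith
  have hmain := sum_norm_sq_le_of_average φ I m r hPne
    (fun i hi => ⟨hm i hi, (hdvd i hi).trans (Nat.cast_dvd_cast (dvd_mul_right _ _))⟩) hN0
    (by nlinarith) T (Finset.card_pos.1 (by exact_mod_cast hTpos)) (by
      intro t ht
      obtain ⟨v, hv, rfl⟩ := Finset.mem_image.1 ht
      obtain ⟨hv1, hv2⟩ := Finset.mem_product.1 hv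
      have h1 : (v.1 : ℝ) ≤ y * sqrtDisc K :=
        (Nat.le_floor_iff (by positivity)).1 (Finset.mem_range.1 hv1).le
      have h2 : (v.2 : ℝ) ≤ y := (Nat.le_floor_iff (by positivity)).1 (Finset.mem_range.1 hv2).le
      have h3 : (P : ℝ) * (sqrtDisc K / (12 * √N)) = y * sqrtDisc K + y * sqrtDisc K := by
        rw [hy]; field_simp; ring
      rw [h3]
      simp only [hf, map_add, map_mul, map_natCast]
      refine (norm_add_le _ _).trans ?_
      rw [norm_mul, Complex.norm_natCast, Complex.norm_natCast]
      gcongr) hM a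
  refine hmain.trans ?_
  have hM0 : 0 ≤ M := by simpa using hM 0 ∅ (by simp)
  have hPT : (P : ℝ) ^ 2 / T.card ≤ 2304 * (N / sqrtDisc K) := by
    rw [div_le_iff₀ hTpos]
    have h1 : (P : ℝ) = 24 * √N * y := by rw [hy]; field_simp
    calc (P : ℝ) ^ 2 = 2304 * (N / sqrtDisc K) * (y ^ 2 * sqrtDisc K / 4) := by
          rw [h1, mul_pow, mul_pow, hsq]; field_simp; ring
      _ ≤ _ := by gcongr
  have hS0 : 0 ≤ ∑ n ∈ normBall K N, ‖a n‖ ^ 2 := Finset.sum_nonneg fun _ _ => by positivity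
  refine mul_le_mul_of_nonneg_right (mul_le_mul_of_nonneg_right ?_ hM0) hS0
  linarith

end Sieve

/-! ### Counting fractions in a disc -/

/-- Inserts |H| ≤ b = 700 Q / d in the Weyl inequality. The target 700 Q d = b d ^ 2 leaves 2 · 2 ^
j spare powers of d, which absorb the j + 3 powers that arise; for this j ≥ 1 is needed. -/
theorem weyl_arithmetic {j : ℕ} (hj : 1 ≤ j) {a h b d Q τ E : ℝ} (hh : 0 ≤ h)
    (hhb : h ≤ b) (hb : b = 700 * (Q / d)) (hb1 : 1 ≤ b) (hd : 1 ≤ d) (hQ : 1 ≤ Q) (hτ : 0 ≤ τ)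
    (hE : 1 ≤ E) (ha : a ^ 2 ^ j ≤
      h ^ (2 ^ j - j - 1) * ((j + 1) * h ^ j + E * (1 + Q ^ (j + 1) * d ^ 2 * τ))) :
    a ^ 2 ^ j ≤ (j + 2) * E * (1 / Q + τ) * (700 * (Q * d)) ^ 2 ^ j := by
  have hj1 : j + 1 ≤ 2 ^ j := Nat.lt_two_pow_self
  have hj3 : j + 3 ≤ 2 * 2 ^ j := by
    obtain ⟨i, rfl⟩ := Nat.exists_eq_add_of_le' hj
    have : i + 1 ≤ 2 ^ i := Nat.lt_two_pow_self
    rw [pow_succ]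
    omega
  have hb0 : 0 < b := by linarith
  have hd0 : 0 < d := by linarith
  have hQ0 : 0 < Q := by linarith
  have hQb : Q ≤ b * d := by rw [hb]; field_simp; linarith
  set X := b ^ 2 ^ j * d ^ (2 * 2 ^ j) with hX
  have hXeq : (700 * (Q * d)) ^ 2 ^ j = X := by
    rw [hX, pow_mul, ← mul_pow, hb]; congr 1; field_simp
  have h1 : b ^ (2 ^ j - 1) ≤ X / Q := by
    rw [le_div_iff₀ hQ0]
    calc b ^ (2 ^ j - 1) * Q ≤ b ^ (2 ^ j - 1) * (b * d) := by gcongr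
      _ = b ^ 2 ^ j * d ^ 1 := by
        rw [pow_one, ← mul_assoc, ← pow_succ, Nat.sub_add_cancel (by omega)]
      _ ≤ _ := by rw [hX]; gcongr; omega
  have h2 : b ^ (2 ^ j - j - 1) * (Q ^ (j + 1) * d ^ 2 * τ) ≤ X * τ := by
    rw [← mul_assoc]
    refine mul_le_mul_of_nonneg_right ?_ hτ
    calc b ^ (2 ^ j - j - 1) * (Q ^ (j + 1) * d ^ 2)
        ≤ b ^ (2 ^ j - j - 1) * ((b * d) ^ (j + 1) * d ^ 2) := by gcongr
      _ = b ^ ((2 ^ j - j - 1) + (j + 1)) * d ^ (j + 3) := by rw [mul_pow]; ring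
      _ = b ^ 2 ^ j * d ^ (j + 3) := by congr 2; omega
      _ ≤ _ := by rw [hX]; gcongr
  have h3 : b ^ (2 ^ j - j - 1) ≤ b ^ (2 ^ j - 1) := by gcongr; omega
  have h4 : b ^ (2 ^ j - j - 1) * b ^ j = b ^ (2 ^ j - 1) := by
    rw [← pow_add]; congr 1; omega
  have hX0 : 0 ≤ X / Q := by positivity
  rw [hXeq]
  calc a ^ 2 ^ j ≤ _ := ha
    _ ≤ b ^ (2 ^ j - j - 1) * ((j + 1) * b ^ j + E * (1 + Q ^ (j + 1) * d ^ 2 * τ)) := by gcongr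
    _ = (j + 1) * (b ^ (2 ^ j - j - 1) * b ^ j) + E * b ^ (2 ^ j - j - 1) +
        E * (b ^ (2 ^ j - j - 1) * (Q ^ (j + 1) * d ^ 2 * τ)) := by ring
    _ ≤ (j + 1) * (E * (X / Q)) + E * (X / Q) + E * (X * τ) := by
        rw [h4]
        have h5 : X / Q ≤ E * (X / Q) := le_mul_of_one_le_left hX0 hE
        gcongr
        · exact h1.trans h5
        · exact h3.trans h1
    _ ≤ (j + 1) * (E * (X / Q)) + E * (X / Q) + (j + 2) * (E * (X * τ)) := by
        have : 0 ≤ E * (X * τ) := by positivity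
        nlinarith [(Nat.cast_nonneg j : (0 : ℝ) ≤ j)]
    _ = _ := by ring

/-- Taking n-th roots: the root is subadditive, and it does not increase C Q ^ ε because that is at
least 1. -/
theorem le_of_pow_le_mul_pow {n : ℕ} (hn : n ≠ 0) {a Y C Q τ ε : ℝ} (ha : 0 ≤ a) (hY : 0 ≤ Y)
    (hC : 1 ≤ C) (hQ : 1 ≤ Q) (hτ : 0 ≤ τ) (hε : 0 < ε)
    (h : a ^ n ≤ C * Q ^ ε * (1 / Q + τ) * Y ^ n) :
    a ≤ C * Q ^ ε * (Q ^ (-(1 / (n : ℝ))) + τ ^ (1 / (n : ℝ))) * Y := by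
  have hn1 : (1 : ℝ) ≤ n := by exact_mod_cast Nat.one_le_iff_ne_zero.2 hn
  have hn0 : (0 : ℝ) ≤ 1 / n := by positivity
  have hn2 : 1 / (n : ℝ) ≤ 1 := by rw [div_le_one (by linarith)]; exact hn1
  have hQ0 : 0 < Q := by linarith
  have hC0 : 0 < C := by linarith
  have hCQ : 1 ≤ C * Q ^ ε := one_le_mul_of_one_le_of_one_le hC (Real.one_le_rpow hQ hε.le)
  have h1 := Real.rpow_le_rpow (by positivity) h hn0
  rw [Real.mul_rpow (by positivity) (by positivity), Real.mul_rpow (by positivity) (by positivity),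
    one_div, Real.pow_rpow_inv_natCast ha hn, Real.pow_rpow_inv_natCast hY hn, ← one_div] at h1
  refine h1.trans (mul_le_mul_of_nonneg_right (mul_le_mul ?_ ?_ (by positivity) (by positivity)) hY)
  · calc (C * Q ^ ε) ^ (1 / (n : ℝ)) ≤ (C * Q ^ ε) ^ (1 : ℝ) := by gcongr
      _ = _ := Real.rpow_one _
  · refine (Real.rpow_add_le_add_rpow (by positivity) hτ hn0 hn2).trans_eq ?_
    rw [one_div Q, Real.inv_rpow hQ0.le, Real.rpow_neg hQ0.le]

section Counting

variable {K : Type*} [Field K] [NumberField K]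
  [Algebra.IsQuadraticExtension ℚ K] [IsTotallyComplex K] (φ : K →+* ℂ)

/-- The number of reduced fractions with denominator of norm at most `Q` in a disc. -/
theorem card_fractions_le {Q N : ℝ} (hQ : 1 ≤ Q) (hN : Q ≤ N) (g : ℂ) (A : Finset (𝓞 K × 𝓞 K))
    (hA : ∀ v ∈ A, v.1 ≠ 0 ∧ IsCoprime v.2 v.1 ∧ ‖intEmb φ v.1‖ ^ 2 ≤ Q ∧
      ‖intEmb φ v.1 * g - intEmb φ v.2‖ ≤ √Q * (sqrtDisc K / (12 * √N))) :
    (A.card : ℝ) ≤ 80000 * sqrtDisc K * (1 + Q * (Q / N)) := by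
  have hd := one_le_sqrtDisc K
  set d := sqrtDisc K
  have hd0 : 0 < d := by linarith
  have hQ0 : 0 < Q := by linarith
  have hN0 : 0 < N := by linarith
  have hsN : 0 < √N := Real.sqrt_pos.2 hN0
  have hsqN := Real.sq_sqrt hN0.le
  have hsqQ := Real.sq_sqrt hQ0.le
  set x := Q / √N with hx
  have hx0 : 0 < x := by positivity
  have hx2 : Q * (Q / N) = x ^ 2 := by rw [hx, div_pow, hsqN]; ring
  have hPρ : 2 * (√Q * (√Q * (d / (12 * √N)))) = d * x / 6 := by
    rw [← mul_assoc √Q, ← pow_two, hsqQ, hx]; field_simp; ring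
  have := card_le_of_det (intEmb φ) (fun y hy => one_le_norm_intEmb φ hy) g (Real.sqrt_nonneg Q) A
    (fun v hv => ⟨(hA v hv).1, (hA v hv).2.1, Real.le_sqrt_of_sq_le (hA v hv).2.2.1,
      (hA v hv).2.2.2⟩) (M := 100 * (1 + d * x / 6 + (d * x / 6) ^ 2 / d)) (fun T hT => by
      rw [hPρ] at hT
      exact card_le_of_norm_intEmb_le φ (by positivity) hT)
  refine this.trans ?_
  have e : (d * x / 6) ^ 2 / d = d * (x ^ 2 / 36) := by field_simp; norm_num
  rw [hx2, e]
  have h1 : d * x ≤ d * (1 + x ^ 2) := by gcongr; nlinarith [sq_nonneg (x - 1)]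
  nlinarith [mul_nonneg hd0.le (sq_nonneg x)]

/-- The trivial bound for the number of numerators per denominator. -/
theorem card_le_card_image_fst {d ρ σ : ℝ} (hdK : d = sqrtDisc K) (hρ : ρ = d * σ / 12)
    (hσ : 0 ≤ σ) (hσ1 : σ ≤ 1) (A : Finset (𝓞 K × 𝓞 K)) (f : 𝓞 K → ℂ)
    (hA : ∀ v ∈ A, ‖f v.1 - intEmb φ v.2‖ ≤ ρ) [DecidableEq (𝓞 K)] :
    (A.card : ℝ) ≤ 100 * (1 + d * σ) * (A.image Prod.fst).card := by
  have hd : 1 ≤ d := hdK ▸ one_le_sqrtDisc K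
  have hd0 : 0 < d := by linarith
  have hρ0 : 0 ≤ ρ := by rw [hρ]; positivity
  have hfib : ∀ q ∈ A.image Prod.fst,
      ((A.filter (fun v => v.1 = q)).card : ℝ) ≤ 100 * (1 + d * σ) := by
    intro q hq
    obtain ⟨u, hu, rfl⟩ := Finset.mem_image.1 hq
    have hinj : Set.InjOn (fun v : 𝓞 K × 𝓞 K => v.2 - u.2)
        (A.filter (fun v => v.1 = u.1) : Set (𝓞 K × 𝓞 K)) := by
      intro v hv w hw h
      rw [Finset.mem_coe, Finset.mem_filter] at hv hw
      exact Prod.ext (hv.2.trans hw.2.symm) (sub_left_injective h)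
    rw [← Finset.card_image_of_injOn hinj]
    refine (card_le_of_norm_intEmb_le φ (r := 2 * ρ) (by positivity) fun t ht => ?_).trans ?_
    · obtain ⟨v, hv, rfl⟩ := Finset.mem_image.1 ht
      obtain ⟨hv1, hv2⟩ := Finset.mem_filter.1 hv
      have h1 := hA v hv1
      have h2 := hA u hu
      rw [hv2] at h1
      rw [map_sub, show intEmb φ v.2 - intEmb φ u.2 =
        (f u.1 - intEmb φ u.2) - (f u.1 - intEmb φ v.2) by ring]
      exact (norm_sub_le _ _).trans (by linarith)
    · rw [← hdK, hρ]
      have e : (2 * (d * σ / 12)) ^ 2 / d = d * σ * σ / 36 := by field_simp; ring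
      rw [e]
      have : d * σ * σ ≤ d * σ * 1 := by gcongr
      have : 0 ≤ d * σ := by positivity
      linarith
  rw [Finset.card_eq_sum_card_image Prod.fst A]
  push_cast
  refine (Finset.sum_le_sum hfib).trans_eq ?_
  rw [Finset.sum_const, nsmul_eq_mul, mul_comm]

end Counting

/-- Here u and v stand for Q ^ (-1 / κ) and τ ^ (1 / κ). The left side is the number of numerators
per denominator times the number of denominators; if Q / d is within the target, no differencing is
needed. -/
theorem trivial_count_le {Q d σ u v : ℝ} (hQ : 1 ≤ Q) (hd : 1 ≤ d) (hσ : 0 ≤ σ) (hσ1 : σ ≤ 1)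
    (hu : 0 ≤ u) (hv : 0 ≤ v) (hQu : √Q ≤ Q * u) (hσv : σ ≤ v)
    (h : Q / d ≤ d * (Q * (u + v))) :
    100 * (1 + d * σ) * (100 * (1 + √Q + Q / d)) ≤ 60000 * (d * (Q * (u + v))) := by
  have hd0 : 0 < d := by linarith
  have hQ0 : 0 < Q := by linarith
  have hsQ : 1 ≤ √Q := Real.one_le_sqrt.2 hQ
  have hQv : Q * σ ≤ Q * v := by gcongr
  have hQv0 : 0 ≤ Q * σ := by positivity
  set W := d * (Q * (u + v)) with hW
  have hZ : Q * (u + v) ≤ W := le_mul_of_one_le_left (by positivity) hd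
  have hsum : Q * (u + v) = Q * u + Q * v := by ring
  have h2 : √Q * (d * σ) ≤ W := by
    have h3 : √Q * σ ≤ √Q * 1 := by gcongr
    calc √Q * (d * σ) = d * (√Q * σ) := by ring
      _ ≤ d * (Q * (u + v)) := mul_le_mul_of_nonneg_left (by linarith) hd0.le
  calc _ ≤ 100 * (1 + d * σ) * (100 * (√Q + √Q + Q / d)) := by gcongr
    _ = 10000 * (2 * √Q + 2 * (√Q * (d * σ)) + Q / d + Q * σ) := by field_simp; ring
    _ ≤ 60000 * W := by linarith

/-- The complementary case: each denominator then has boundedly many numerators, and Q / d dominates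
√Q in the lattice point count. -/
theorem small_discriminant {Q d σ u v : ℝ} (hQ : 1 ≤ Q) (hd : 1 ≤ d)
    (hu : 0 ≤ u) (hv : 0 ≤ v) (hQu : √Q ≤ Q * u) (hσv : σ ≤ v)
    (h : d * (Q * (u + v)) < Q / d) : d * σ ≤ 1 ∧ d ≤ √Q := by
  have hd0 : 0 < d := by linarith
  have hQ0 : 0 < Q := by linarith
  have hsQ : 0 < √Q := Real.sqrt_pos.2 hQ0
  rw [lt_div_iff₀ hd0] at h
  have hlt : d * d * (u + v) < 1 := by
    have : Q * (d * d * (u + v)) < Q * 1 := by linarith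
    exact lt_of_mul_lt_mul_left this hQ0.le
  have hdd : 0 ≤ d * d * u := by positivity
  have hdv : 0 ≤ d * d * v := by positivity
  constructor
  · calc d * σ ≤ d * (d * v) := by
          gcongr
          exact hσv.trans (le_mul_of_one_le_left hv hd)
      _ ≤ 1 := by linarith
  · have h1 : d * d * √Q ≤ √Q * √Q := by
      rw [Real.mul_self_sqrt hQ0.le]
      calc d * d * √Q ≤ d * d * (Q * u) := by gcongr
        _ = Q * (d * d * u) := by ring
        _ ≤ Q * 1 := by gcongr; linarith
        _ = Q := mul_one Q
    have h2 : d * d ≤ √Q := le_of_mul_le_mul_right h1 hsQ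
    exact (le_mul_of_one_le_left hd0.le hd).trans h2

/-- Denominators whose `(j + 1)`-th powers multiply `g` close to the lattice are rare, if an
associated linear problem has few solutions. -/
theorem exists_power_denominators_bound {j : ℕ} (hj : 1 ≤ j) {ε : ℝ} (hε : 0 < ε) :
    ∃ C : ℝ, 1 ≤ C ∧ ∀ (K : Type*) [Field K] [NumberField K] [Algebra.IsQuadraticExtension ℚ K]
      [IsTotallyComplex K] (φ : K →+* ℂ) (Q τ σ ρ : ℝ), 1 ≤ Q → sqrtDisc K ≤ √Q → 0 ≤ σ →
      σ ^ 2 = τ → ρ = sqrtDisc K * σ / 12 →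
      ∀ (g : ℂ) (A : Finset (𝓞 K)) (r : 𝓞 K → 𝓞 K),
      (∀ q ∈ A, ‖intEmb φ q‖ ≤ √Q) →
      (∀ q ∈ A, ‖intEmb φ q ^ (j + 1) * g - intEmb φ (r q)‖ ≤ ρ) →
      (∀ S : Finset (𝓞 K × 𝓞 K), (∀ v ∈ S, ‖intEmb φ v.1‖ ≤ 2 ^ j * √Q ^ (j + 1) ∧
        ‖intEmb φ v.1 * g - intEmb φ v.2‖ ≤ 2 ^ j * ρ) →
        (S.card : ℝ) ≤ 10 ^ 6 * (1 + 2 ^ j * ρ * (2 ^ j * √Q ^ (j + 1))) ^ 2) →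
      (A.card : ℝ) ≤ C * Q ^ ε * (Q ^ (-(1 / (2 ^ j : ℕ) : ℝ)) + τ ^ (1 / (2 ^ j : ℕ) : ℝ)) *
        (700 * (Q * sqrtDisc K)) := by
  classical
  -- The exponent is chosen so that the (j + 1)-th power of the divisor bound, at elements of size
  -- about Q ^ ((j + 1) / 2), is O(Q ^ ε).
  obtain ⟨C₁, hC₁, hdiv⟩ := exists_divisor_bound (ε := 2 * ε / (j + 1) ^ 2) (by positivity)
  set ε' := 2 * ε / (j + 1 : ℝ) ^ 2 with hε'
  set C₂ : ℝ := max 1 ((C₁ * (2 ^ j) ^ ε') ^ (j + 1)) with hC₂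
  set C₃ : ℝ := (j + 2) * (C₂ * (2 * 10 ^ 6 * 16 ^ j)) with hC₃
  have hC₂1 : 1 ≤ C₂ := le_max_left _ _
  have h16 : (1 : ℝ) ≤ 16 ^ j := one_le_pow₀ (by norm_num)
  have hC₃1 : 1 ≤ C₃ := by
    have h1 : (1 : ℝ) ≤ C₂ * (2 * 10 ^ 6 * 16 ^ j) :=
      one_le_mul_of_one_le_of_one_le hC₂1 (by linarith)
    have h2 : (1 : ℝ) ≤ j + 2 := by linarith [(Nat.cast_nonneg j : (0 : ℝ) ≤ j)]
    exact one_le_mul_of_one_le_of_one_le h2 h1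
  refine ⟨C₃, hC₃1, fun K _ _ _ _ φ Q τ σ ρ hQ hdQ hσ0 hστ hρσ g A r hA hr hlin => ?_⟩
  have hd := one_le_sqrtDisc K
  set d := sqrtDisc K with hdK
  have hd0 : 0 < d := by linarith
  have hQ0 : 0 < Q := by linarith
  have hsQ : 1 ≤ √Q := Real.one_le_sqrt.2 hQ
  have hsQ0 : 0 < √Q := by linarith
  have hsqQ := Real.sq_sqrt hQ0.le
  have hτ0 : 0 ≤ τ := hστ ▸ sq_nonneg σ
  have hQε : 1 ≤ Q ^ ε := Real.one_le_rpow hQ hε.le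
  have hsQd : √Q ≤ Q / d := by
    rw [le_div_iff₀ hd0]
    calc √Q * d ≤ √Q * √Q := by gcongr
      _ = Q := Real.mul_self_sqrt hQ0.le
  set H := normBall K (4 * Q) with hH
  have hHmem : ∀ h ∈ H, ‖intEmb φ h‖ ≤ 2 * √Q := by
    intro h hh
    have := (mem_normBall_iff φ).1 hh
    refine (abs_le_of_sq_le_sq' ?_ (by positivity)).2
    rw [mul_pow, hsqQ]; linarith
  have hHcard : (H.card : ℝ) ≤ 700 * (Q / d) := by
    have := card_le_of_norm_intEmb_le φ (by positivity) hHmem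
    rw [mul_pow, hsqQ, ← hdK, mul_div_assoc] at this
    linarith
  set D : ℕ := ⌊C₁ * (2 ^ j * √Q ^ (j + 1)) ^ ε'⌋₊ with hD
  have hε'0 : 0 ≤ ε' := by positivity
  have hDle : (D : ℝ) ^ (j + 1) ≤ C₂ * Q ^ ε := by
    have h1 : (D : ℝ) ≤ C₁ * (2 ^ j * √Q ^ (j + 1)) ^ ε' := Nat.floor_le (by positivity)
    have h2 : ((√Q ^ (j + 1)) ^ ε') ^ (j + 1) = Q ^ ε := by
      rw [Real.sqrt_eq_rpow, ← Real.rpow_natCast, ← Real.rpow_natCast, ← Real.rpow_mul hQ0.le,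
        ← Real.rpow_mul hQ0.le, ← Real.rpow_mul hQ0.le]
      congr 1
      rw [hε']
      push_cast
      field_simp
    calc (D : ℝ) ^ (j + 1) ≤ (C₁ * (2 ^ j * √Q ^ (j + 1)) ^ ε') ^ (j + 1) := by gcongr
      _ = (C₁ * (2 ^ j) ^ ε') ^ (j + 1) * ((√Q ^ (j + 1)) ^ ε') ^ (j + 1) := by
        rw [Real.mul_rpow (by positivity) (by positivity), ← mul_assoc, mul_pow]
      _ ≤ _ := by rw [h2]; gcongr; exact le_max_right _ _
  have hweyl := card_pow_le_of_pow_mul_near (intEmb φ) g j (P := √Q ^ (j + 1)) (ρ := ρ) (D := D)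
    A H r (fun a ha b hb => (mem_normBall_iff φ).2 (by
      have h1 := norm_sub_le (intEmb φ b) (intEmb φ a)
      have h2 := hA a ha
      have h3 := hA b hb
      rw [map_sub]
      calc _ ≤ (2 * √Q) ^ 2 := by gcongr; linarith
        _ = 4 * Q := by rw [mul_pow, hsqQ]; norm_num)) (fun q hq => by
      have := hA q hq
      gcongr) hr (fun x hx hxP => by
      obtain ⟨S, hS, hScard⟩ := hdiv K φ x hx
      refine ⟨S, hS, Nat.le_floor (hScard.trans ?_)⟩
      gcongr) hlin
  -- The factor 16 ^ j comes from squaring the two factors 2 ^ j by which j differences enlarge the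
  -- size and the error.
  have hM : 10 ^ 6 * (1 + 2 ^ j * ρ * (2 ^ j * √Q ^ (j + 1))) ^ 2 ≤
      2 * 10 ^ 6 * 16 ^ j * (1 + Q ^ (j + 1) * d ^ 2 * τ) := by
    set x := 2 ^ j * ρ * (2 ^ j * √Q ^ (j + 1)) with hx
    set y := Q ^ (j + 1) * d ^ 2 * τ with hy
    have hy0 : 0 ≤ y := by positivity
    have h1 : x ^ 2 = 16 ^ j * y / 144 := by
      have h4 : ((2 : ℝ) ^ j * 2 ^ j) ^ 2 = 16 ^ j := by
        rw [← mul_pow, ← pow_mul, mul_comm j 2, pow_mul]; norm_num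
      have h5 : (√Q ^ (j + 1)) ^ 2 = Q ^ (j + 1) := by
        rw [← pow_mul, mul_comm, pow_mul, hsqQ]
      calc x ^ 2 = ((2 : ℝ) ^ j * 2 ^ j) ^ 2 * (√Q ^ (j + 1)) ^ 2 * ρ ^ 2 := by rw [hx]; ring
        _ = _ := by rw [h4, h5, hρσ, hy, ← hστ]; ring
    have h2 : 0 ≤ 16 ^ j * y := by positivity
    have h3 : (1 + x) ^ 2 ≤ 2 * (1 + x ^ 2) := by
      linarith [sq_nonneg (x - 1), sub_sq x 1, add_sq 1 x]
    linarith
  refine le_of_pow_le_mul_pow (n := 2 ^ j) (by positivity) (by positivity) (by positivity) hC₃1 hQ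
    hτ0 hε ?_
  refine (weyl_arithmetic hj (a := A.card) (E := C₂ * Q ^ ε * (2 * 10 ^ 6 * 16 ^ j))
    (by positivity) hHcard rfl (by linarith) hd hQ hτ0
    (one_le_mul_of_one_le_of_one_le (one_le_mul_of_one_le_of_one_le hC₂1 hQε) (by linarith))
    (hweyl.trans ?_)).trans_eq ?_
  · refine mul_le_mul_of_nonneg_left (add_le_add le_rfl ?_) (by positivity)
    rw [mul_assoc (C₂ * Q ^ ε)]
    exact mul_le_mul hDle hM (by positivity) (by positivity)
  · rw [hC₃]
    ring

/-- The number of reduced fractions with `(j + 1)`-th power denominators in a disc. -/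
theorem exists_power_fractions_bound {j : ℕ} (hj : 1 ≤ j) {ε : ℝ} (hε : 0 < ε) :
    ∃ C : ℝ, 0 < C ∧ ∀ (K : Type*) [Field K] [NumberField K] [Algebra.IsQuadraticExtension ℚ K]
      [IsTotallyComplex K] (φ : K →+* ℂ) (Q N : ℝ), 1 ≤ Q → Q ^ (j + 1) ≤ N →
      ∀ (g : ℂ) (A : Finset (𝓞 K × 𝓞 K)),
      (∀ v ∈ A, v.1 ≠ 0 ∧ IsCoprime v.2 v.1 ∧ ‖intEmb φ v.1‖ ^ 2 ≤ Q ∧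
        ‖intEmb φ v.1 ^ (j + 1) * g - intEmb φ v.2‖ ≤
          √Q ^ (j + 1) * (sqrtDisc K / (12 * √N))) →
      (A.card : ℝ) ≤ C * Q ^ ε * (sqrtDisc K * (Q * (Q ^ (-(1 / (2 ^ j : ℕ) : ℝ)) +
        (Q ^ (j + 1) / N) ^ (1 / (2 ^ j : ℕ) : ℝ)))) := by
  classical
  obtain ⟨C₃, hC₃1, hweyl⟩ := exists_power_denominators_bound hj hε
  refine ⟨200000 * C₃, by positivity, fun K _ _ _ _ φ Q N hQ hQN g A hA => ?_⟩
  have hone : ∀ y : 𝓞 K, y ≠ 0 → 1 ≤ ‖intEmb φ y‖ := fun y hy => one_le_norm_intEmb φ hy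
  have hd := one_le_sqrtDisc K
  set d := sqrtDisc K with hdK
  have hd0 : 0 < d := by linarith
  have hQ0 : 0 < Q := by linarith
  have hN0 : 0 < N := lt_of_lt_of_le (by positivity) hQN
  have hsQ : 1 ≤ √Q := Real.one_le_sqrt.2 hQ
  have hsQ0 : 0 < √Q := by linarith
  have hsqQ := Real.sq_sqrt hQ0.le
  have hsN0 : 0 < √N := Real.sqrt_pos.2 hN0
  have hsqN := Real.sq_sqrt hN0.le
  have hn2 : (2 : ℝ) ≤ (2 ^ j : ℕ) := by
    have : 2 ^ 1 ≤ 2 ^ j := Nat.pow_le_pow_right (by norm_num) hj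
    exact_mod_cast this
  -- Here j ≥ 1 matters: κ ≥ 2 gives √Q ≤ Q ^ (1 - 1 / κ) and σ = τ ^ (1 / 2) ≤ τ ^ (1 / κ).
  have hnhalf : 1 / ((2 ^ j : ℕ) : ℝ) ≤ 1 / 2 := one_div_le_one_div_of_le (by norm_num) hn2
  set τ := Q ^ (j + 1) / N with hτ
  have hτ0 : 0 < τ := by positivity
  have hτ1 : τ ≤ 1 := (div_le_one hN0).2 hQN
  set σ := √Q ^ (j + 1) / √N with hσ
  have hσ0 : 0 < σ := by positivity
  have hστ : σ ^ 2 = τ := by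
    rw [hσ, hτ, div_pow, hsqN, ← pow_mul, mul_comm, pow_mul, hsqQ]
  have hσ1 : σ ≤ 1 := by
    rw [← hστ] at hτ1
    exact (sq_le_one_iff₀ hσ0.le).1 hτ1
  set ρ := √Q ^ (j + 1) * (d / (12 * √N)) with hρ
  have hρσ : ρ = d * σ / 12 := by rw [hρ, hσ]; field_simp
  have hρ0 : 0 < ρ := by rw [hρσ]; positivity
  set u := Q ^ (-(1 / (2 ^ j : ℕ) : ℝ)) with hu
  set v := τ ^ (1 / (2 ^ j : ℕ) : ℝ) with hv
  have hu0 : 0 < u := by positivity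
  have hv0 : 0 < v := by positivity
  have hQu : √Q ≤ Q * u := by
    rw [Real.sqrt_eq_rpow, hu]
    nth_rewrite 2 [← Real.rpow_one Q]
    rw [← Real.rpow_add hQ0]
    exact Real.rpow_le_rpow_of_exponent_le hQ (by linarith)
  have hσv : σ ≤ v := by
    rw [hv, ← Real.sqrt_sq hσ0.le, hστ, Real.sqrt_eq_rpow]
    exact Real.rpow_le_rpow_of_exponent_ge hτ0 hτ1 hnhalf
  have hQε : 1 ≤ Q ^ ε := Real.one_le_rpow hQ hε.le
  set W := d * (Q * (u + v)) with hW
  have hW1 : 1 ≤ W := by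
    refine one_le_mul_of_one_le_of_one_le hd ?_
    calc 1 ≤ Q * u := hsQ.trans hQu
      _ ≤ Q * (u + v) := by gcongr; linarith
  have hCW : ∀ c : ℝ, c ≤ 200000 → c * W ≤ 200000 * C₃ * Q ^ ε * W := by
    intro c hc
    refine mul_le_mul_of_nonneg_right ?_ (by linarith)
    have h1 : 1 ≤ C₃ * Q ^ ε := one_le_mul_of_one_le_of_one_le hC₃1 hQε
    linarith
  set A₀ := A.image Prod.fst with hA₀
  have hA₀mem : ∀ q ∈ A₀, ‖intEmb φ q‖ ≤ √Q := by
    intro q hq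
    obtain ⟨w, hw, rfl⟩ := Finset.mem_image.1 hq
    exact Real.le_sqrt_of_sq_le (hA w hw).2.2.1
  have hAA₀ : (A.card : ℝ) ≤ 100 * (1 + d * σ) * A₀.card :=
    card_le_card_image_fst φ hdK hρσ hσ0.le hσ1 A (fun q => intEmb φ q ^ (j + 1) * g)
      (fun w hw => (hA w hw).2.2.2)
  by_cases htriv : Q / d ≤ W
  · have hA₀card := card_le_of_norm_intEmb_le φ hsQ0.le hA₀mem
    rw [hsqQ, ← hdK] at hA₀card
    refine le_trans ?_ (hCW 60000 (by norm_num))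
    refine hAA₀.trans (le_trans ?_
      (trivial_count_le hQ hd hσ0.le hσ1 hu0.le hv0.le hQu hσv htriv))
    gcongr
  obtain ⟨hdσ, hdQ⟩ := small_discriminant hQ hd hu0.le hv0.le hQu hσv (not_le.1 htriv)
  have hA200 : (A.card : ℝ) ≤ 200 * A₀.card := by
    refine hAA₀.trans (mul_le_mul_of_nonneg_right ?_ (by positivity))
    linarith
  have h2j : (1 : ℝ) ≤ 2 ^ j := one_le_pow₀ (by norm_num)
  have hP1 : 1 ≤ √Q ^ (j + 1) := one_le_pow₀ hsQ
  -- The dichotomy is applied at the enlarged scales produced by j differences. In the first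
  -- alternative at most 144 fractions occur, which is within the target because W ≥ 1.
  rcases exists_approx_or_card_le (intEmb φ) hone g (P := 2 ^ j * √Q ^ (j + 1)) (ρ := 2 ^ j * ρ)
    (one_le_mul_of_one_le_of_one_le h2j hP1) (by positivity) with
    ⟨x₀, y₀, hx₀, hx₀ρ, h₀⟩ | hlin
  · refine le_trans ?_ (hCW 144 (by norm_num))
    have hρ' : ‖intEmb φ x₀‖ * ρ < 1 / 4 := by
      refine lt_of_le_of_lt ?_ hx₀ρ
      gcongr
      exact le_mul_of_one_le_left hρ0.le h2j
    have := card_le_of_approx (intEmb φ) hone g (k := j + 1) (ρ := ρ) (by omega)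
      (one_le_mul_of_one_le_of_one_le h2j hP1) hx₀ hρ' h₀ A (fun w hw => by
        obtain ⟨h1, h2, h3, h4⟩ := hA w hw
        refine ⟨h1, h2, ?_, h4⟩
        calc ‖intEmb φ w.1‖ ^ (j + 1) ≤ √Q ^ (j + 1) := by
              gcongr; exact Real.le_sqrt_of_sq_le h3
          _ ≤ _ := le_mul_of_one_le_left (by positivity) h2j)
    linarith
  have hr : ∀ q ∈ A₀, ∃ r, (q, r) ∈ A := by
    intro q hq
    obtain ⟨w, hw, rfl⟩ := Finset.mem_image.1 hq
    exact ⟨w.2, hw⟩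
  choose! r hrA using hr
  have hfinal := hweyl K φ Q τ σ ρ hQ hdQ hσ0.le hστ hρσ g A₀ r hA₀mem
    (fun q hq => (hA _ (hrA q hq)).2.2.2) hlin
  calc (A.card : ℝ) ≤ 200 * A₀.card := hA200
    _ ≤ 200 * (C₃ * Q ^ ε * (u + v) * (700 * (Q * d))) := by gcongr
    _ = 140000 * (C₃ * Q ^ ε * W) := by rw [hW]; ring
    _ ≤ 200000 * (C₃ * Q ^ ε * W) := by gcongr; norm_num
    _ = _ := by ring

/-! ### Assembling the theorem -/

section Assembly

variable {K : Type*} [Field K] [NumberField K]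
  [Algebra.IsQuadraticExtension ℚ K] [IsTotallyComplex K] (φ : K →+* ℂ)

/-- The large sieve for reduced fractions with `k`-th power denominators. -/
theorem sum_expSum_sq_le {k : ℕ} (hk : 1 ≤ k) {Q N M : ℝ} (hN : 1 ≤ N)
    (hM : ∀ (g : ℂ) (A : Finset (𝓞 K × 𝓞 K)),
      (∀ v ∈ A, v.1 ≠ 0 ∧ IsCoprime v.2 v.1 ∧ ‖intEmb φ v.1‖ ^ 2 ≤ Q ∧
        ‖intEmb φ v.1 ^ k * g - intEmb φ v.2‖ ≤ √Q ^ k * (sqrtDisc K / (12 * √N))) →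
      (A.card : ℝ) ≤ M) (a : 𝓞 K → ℂ) :
    ∑ q ∈ nonzeroNormBall K Q, ∑ᶠ r ∈ reducedResidues q k,
      ‖expSum φ a N ((Quotient.out r : 𝓞 K) / (q : K) ^ k)‖ ^ 2 ≤
      9216 * (N / sqrtDisc K) * M * ∑ n ∈ normBall K N, ‖a n‖ ^ 2 := by
  classical
  have hd := one_le_sqrtDisc K
  set R : (q : 𝓞 K) → Finset (𝓞 K ⧸ Ideal.span {q ^ k}) := fun q =>
    if hq : q ≠ 0 then (reducedResidues_finite hq k).toFinset else ∅ with hR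
  have hRmem : ∀ q r, r ∈ R q → IsCoprime (Quotient.out r) q := by
    intro q r hr
    by_cases hq : q ≠ 0
    · rw [hR] at hr
      simp only [dif_pos hq, Set.Finite.mem_toFinset] at hr
      exact hr
    · rw [hR] at hr
      simp only [dif_neg hq, Finset.notMem_empty] at hr
  have hout : ∀ i : Σ q : 𝓞 K, 𝓞 K ⧸ Ideal.span {q ^ k},
      Ideal.Quotient.mk _ (Quotient.out i.2) = i.2 := fun i => Ideal.Quotient.mk_out i.2
  have hlarge := large_sieve φ ((nonzeroNormBall K Q).sigma R)
    (fun i => i.1 ^ k) (fun i => Quotient.out i.2)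
    (fun i hi => pow_ne_zero k
      ((mem_nonzeroNormBall_iff φ).1 (Finset.mem_sigma.1 hi).1).2) hN (M := M) (fun g J hJ => by
      have hmk : ∀ v ∈ J, v.1.2 = Ideal.Quotient.mk _ v.2 := by
        intro v hv
        rw [← hout v.1, Ideal.Quotient.eq, Ideal.mem_span_singleton]
        exact (hJ v hv).2.1
      -- The sieve counts triples (q, r, s) with s in the class r. The class is determined by s, so
      -- they may be counted as fractions s / q ^ k; coprimality to q passes from the chosen
      -- representative to s.
      have hinj : Set.InjOn (fun v : (Σ q : 𝓞 K, 𝓞 K ⧸ Ideal.span {q ^ k}) × 𝓞 K =>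
          (v.1.1, v.2)) J := by
        rintro ⟨⟨q, r⟩, s⟩ hv ⟨⟨q', r'⟩, s'⟩ hw h
        simp only [Prod.mk.injEq] at h
        obtain ⟨rfl, rfl⟩ := h
        have h1 := hmk _ hv
        have h2 := hmk _ hw
        simp only at h1 h2
        rw [h1, h2]
      rw [← Finset.card_image_of_injOn hinj]
      refine hM g _ fun u hu => ?_
      obtain ⟨v, hv, rfl⟩ := Finset.mem_image.1 hu
      obtain ⟨h1, ⟨l, hl⟩, h3⟩ := hJ v hv
      obtain ⟨h4, h5⟩ := Finset.mem_sigma.1 h1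
      obtain ⟨h6, h7⟩ := (mem_nonzeroNormBall_iff φ).1 h4
      refine ⟨h7, ?_, h6, ?_⟩
      · have h8 : v.2 = Quotient.out v.1.2 + v.1.1 * (-(v.1.1 ^ (k - 1) * l)) := by
          have h9 : v.1.1 ^ k = v.1.1 * v.1.1 ^ (k - 1) := by
            rw [← pow_succ', Nat.sub_add_cancel hk]
          linear_combination -hl - l * h9
        change IsCoprime v.2 v.1.1
        rw [h8]
        exact (hRmem _ _ h5).add_mul_left_left _
      · rw [norm_sub_rev]
        simp only [map_pow, norm_pow] at h3
        refine h3.trans ?_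
        have h10 : 0 ≤ sqrtDisc K / (12 * √N) := by
          have := Real.sqrt_nonneg N
          exact div_nonneg (by linarith) (by linarith)
        refine mul_le_mul_of_nonneg_right ?_ h10
        exact pow_le_pow_left₀ (norm_nonneg _) (Real.le_sqrt_of_sq_le h6) k) a
  rw [Finset.sum_sigma] at hlarge
  refine le_of_eq_of_le (Finset.sum_congr rfl fun q hq => ?_) hlarge
  have hq0 := ((mem_nonzeroNormBall_iff φ).1 hq).2
  rw [finsum_mem_eq_finite_toFinset_sum _ (reducedResidues_finite hq0 k)]
  simp only [hR, dif_pos hq0]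
  refine Finset.sum_congr rfl fun r _ => ?_
  rw [expSum]
  congr 3 with n
  simp [mul_div_assoc]

/-- Extending the coefficients by zero allows N to be replaced by max N (Q ^ k), as the fraction
count requires. -/
theorem expSum_extend {a : 𝓞 K → ℂ} {N N' : ℝ} (h : N ≤ N') (z : K) :
    expSum φ (Set.indicator (normBall K N) a) N' z = expSum φ a N z := by
  classical
  have hsub : normBall K N ⊆ normBall K N' := fun n hn =>
    (mem_normBall_iff φ).2 (((mem_normBall_iff φ).1 hn).trans h)
  rw [expSum, expSum, ← Finset.sum_subset hsub]
  · exact Finset.sum_congr rfl fun n hn => by rw [Set.indicator_of_mem hn]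
  · intro n _ hn
    rw [Set.indicator_of_notMem hn, zero_mul]

theorem sum_norm_sq_extend {a : 𝓞 K → ℂ} {N N' : ℝ} (h : N ≤ N') :
    ∑ n ∈ normBall K N', ‖Set.indicator (normBall K N) a n‖ ^ 2 =
      ∑ n ∈ normBall K N, ‖a n‖ ^ 2 := by
  classical
  obtain ⟨φ⟩ : Nonempty (K →+* ℂ) := inferInstance
  have hsub : normBall K N ⊆ normBall K N' := fun n hn =>
    (mem_normBall_iff φ).2 (((mem_normBall_iff φ).1 hn).trans h)
  rw [← Finset.sum_subset hsub]
  · exact Finset.sum_congr rfl fun n hn => by rw [Set.indicator_of_mem hn]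
  · intro n _ hn
    rw [Set.indicator_of_notMem hn, norm_zero, zero_pow two_ne_zero]

end Assembly

/-- The number of reduced fractions with `(j + 1)`-th power denominators in a disc, including the
case of plain denominators. -/
theorem exists_fractions_bound (j : ℕ) {ε : ℝ} (hε : 0 < ε) :
    ∃ C : ℝ, 0 < C ∧ ∀ (K : Type*) [Field K] [NumberField K] [Algebra.IsQuadraticExtension ℚ K]
      [IsTotallyComplex K] (φ : K →+* ℂ) (Q N : ℝ), 1 ≤ Q → Q ^ (j + 1) ≤ N →
      ∀ (g : ℂ) (A : Finset (𝓞 K × 𝓞 K)),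
      (∀ v ∈ A, v.1 ≠ 0 ∧ IsCoprime v.2 v.1 ∧ ‖intEmb φ v.1‖ ^ 2 ≤ Q ∧
        ‖intEmb φ v.1 ^ (j + 1) * g - intEmb φ v.2‖ ≤
          √Q ^ (j + 1) * (sqrtDisc K / (12 * √N))) →
      (A.card : ℝ) ≤ C * Q ^ ε * (sqrtDisc K * (Q * (Q ^ (-(1 / (2 ^ j : ℕ) : ℝ)) +
        (Q ^ (j + 1) / N) ^ (1 / (2 ^ j : ℕ) : ℝ)))) := by
  rcases Nat.eq_zero_or_pos j with rfl | hj
  -- For plain denominators there is nothing to difference, and the determinant count already gives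
  -- 1 + Q ^ 2 / N.
  · refine ⟨80000, by norm_num, fun K _ _ _ _ φ Q N hQ hN g A hA => ?_⟩
    simp only [zero_add, pow_one, pow_zero] at hN hA ⊢
    have hd := one_le_sqrtDisc K
    have hQ0 : 0 < Q := by linarith
    have hN0 : 0 < N := by linarith
    have h1 : Q * (Q ^ (-(1 / (1 : ℕ) : ℝ)) + (Q / N) ^ (1 / (1 : ℕ) : ℝ)) = 1 + Q * (Q / N) := by
      rw [Nat.cast_one, div_one, Real.rpow_one, Real.rpow_neg_one]
      field_simp
    rw [h1]
    refine (card_fractions_le φ hQ hN g A hA).trans ?_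
    have h2 : 1 ≤ Q ^ ε := Real.one_le_rpow hQ hε.le
    have h3 : 0 ≤ sqrtDisc K * (1 + Q * (Q / N)) := mul_nonneg (by linarith) (by positivity)
    calc 80000 * sqrtDisc K * (1 + Q * (Q / N))
        = 80000 * 1 * (sqrtDisc K * (1 + Q * (Q / N))) := by ring
      _ ≤ _ := mul_le_mul_of_nonneg_right (by linarith) h3
  · exact exists_power_fractions_bound hj hε

/-- If N ≥ Q ^ (j + 1), the two summands on the left are exactly the last two terms on the right.
Otherwise N' = Q ^ (j + 1), the second power is 1, and everything is at most 2 Q ^ (j + 2). -/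
theorem large_sieve_exponents {j : ℕ} {κ Q N N' : ℝ} (hκ : κ = (2 ^ j : ℕ)) (hQ : 1 ≤ Q)
    (hN : 1 ≤ N) (hN' : N' = max N (Q ^ (j + 1))) :
    N' * (Q * (Q ^ (-(1 / κ)) + (Q ^ (j + 1) / N') ^ (1 / κ))) ≤
      2 * (Q ^ (j + 1 + 1) + N * Q ^ (1 - 1 / κ) +
        N ^ (1 - 1 / κ) * Q ^ (1 + ((j + 1 : ℕ) : ℝ) / κ)) := by
  have hQ0 : 0 < Q := by linarith
  have hN0 : 0 < N := by linarith
  have hκ0 : 0 < κ := by rw [hκ]; positivity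
  rcases le_total (Q ^ (j + 1)) N with h | h
  · rw [max_eq_left h] at hN'
    rw [hN']
    have h1 : Q * Q ^ (-(1 / κ)) = Q ^ (1 - 1 / κ) := by
      rw [sub_eq_add_neg, Real.rpow_add hQ0, Real.rpow_one]
    have h2 : N * (Q * (Q ^ (j + 1) / N) ^ (1 / κ)) =
        N ^ (1 - 1 / κ) * Q ^ (1 + ((j + 1 : ℕ) : ℝ) / κ) := by
      rw [Real.div_rpow (by positivity) hN0.le, Real.rpow_add hQ0, Real.rpow_sub hN0,
        Real.rpow_one, Real.rpow_one, ← Real.rpow_natCast Q (j + 1), ← Real.rpow_mul hQ0.le,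
        mul_one_div]
      ring
    have h3 : 0 ≤ Q ^ (j + 1 + 1) := by positivity
    have h4 : 0 ≤ N * Q ^ (1 - 1 / κ) := by positivity
    have h5 : 0 ≤ N ^ (1 - 1 / κ) * Q ^ (1 + ((j + 1 : ℕ) : ℝ) / κ) := by positivity
    rw [mul_add, mul_add, h1, h2]
    linarith
  · rw [max_eq_right h] at hN'
    rw [hN', div_self (by positivity), Real.one_rpow]
    have h1 : Q ^ (-(1 / κ)) ≤ 1 :=
      Real.rpow_le_one_of_one_le_of_nonpos hQ (by rw [neg_nonpos]; positivity)
    have h4 : 0 ≤ N * Q ^ (1 - 1 / κ) := by positivity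
    have h5 : 0 ≤ N ^ (1 - 1 / κ) * Q ^ (1 + ((j + 1 : ℕ) : ℝ) / κ) := by positivity
    calc Q ^ (j + 1) * (Q * (Q ^ (-(1 / κ)) + 1)) ≤ Q ^ (j + 1) * (Q * (1 + 1)) := by gcongr
      _ = 2 * Q ^ (j + 1 + 1) := by ring
      _ ≤ _ := by linarith

theorem theorem1p1 (k : ℕ) (hk : 1 ≤ k) (κ : ℝ) (hκ : κ = 2 ^ (k - 1)) (ε : ℝ) (hε : 0 < ε) :
    ∃ C : ℝ, 0 < C ∧
      ∀ (K : Type*) [Field K] [NumberField K] [Algebra.IsQuadraticExtension ℚ K]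
        [IsTotallyComplex K] (φ : K →+* ℂ) (Q N : ℝ), 1 ≤ Q → 1 ≤ N → ∀ a : 𝓞 K → ℂ,
          ∑ q ∈ nonzeroNormBall K Q, ∑ᶠ r ∈ reducedResidues q k,
              ‖expSum φ a N ((Quotient.out r : 𝓞 K) / (q : K) ^ k)‖ ^ 2 ≤
            C * (Q * N) ^ ε *
              (Q ^ (k + 1) + N * Q ^ (1 - 1 / κ) + N ^ (1 - 1 / κ) * Q ^ (1 + k / κ)) *
              ∑ n ∈ normBall K N, ‖a n‖ ^ 2 := by
  obtain ⟨j, rfl⟩ := Nat.exists_eq_add_of_le' hk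
  rw [Nat.add_sub_cancel] at hκ
  have hκ' : κ = (2 ^ j : ℕ) := by rw [hκ]; push_cast; rfl
  obtain ⟨C, hC, hcount⟩ := exists_fractions_bound j hε
  refine ⟨9216 * C * 2, by positivity, fun K _ _ _ _ φ Q N hQ hN a => ?_⟩
  have hQ0 : 0 < Q := by linarith
  have hd := one_le_sqrtDisc K
  have hd0 : 0 < sqrtDisc K := by linarith
  set N' := max N (Q ^ (j + 1)) with hN'
  have hNN' : N ≤ N' := le_max_left _ _
  have hN'1 : 1 ≤ N' := hN.trans hNN'
  have hsieve := sum_expSum_sq_le φ hk hN'1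
    (fun g A hA => hcount K φ Q N' hQ (le_max_right _ _) g A hA)
    (Set.indicator (normBall K N) a)
  simp only [expSum_extend φ hNN', sum_norm_sq_extend hNN'] at hsieve
  refine hsieve.trans (mul_le_mul_of_nonneg_right ?_
    (Finset.sum_nonneg fun _ _ => by positivity))
  rw [← hκ']
  have hexp := large_sieve_exponents hκ' hQ hN hN'
  set X := Q * (Q ^ (-(1 / κ)) + (Q ^ (j + 1) / N') ^ (1 / κ)) with hX
  set Y := Q ^ (j + 1 + 1) + N * Q ^ (1 - 1 / κ) +
    N ^ (1 - 1 / κ) * Q ^ (1 + ((j + 1 : ℕ) : ℝ) / κ) with hY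
  have hX0 : 0 ≤ X := by positivity
  -- The factor d lost in the fraction count cancels the 1 / d gained in the sieve, so no dependence
  -- on the field remains.
  calc 9216 * (N' / sqrtDisc K) * (C * Q ^ ε * (sqrtDisc K * X))
      = 9216 * C * Q ^ ε * (N' * X) := by field_simp
    _ ≤ 9216 * C * (Q * N) ^ ε * (2 * Y) := by
        gcongr
        exact le_mul_of_one_le_right hQ0.le hN
    _ = _ := by ring
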